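/- Let $\mathbb K$ be a normed cone, i.e. an abelian topological semigroup with neutral element $\mathbf e$ that is a Polish space, with a continuous multiplication $(a,x)\mapsto ax$ by scalars $a>0$ satisfying $a(x+y)=ax+ay$, $a(bx)=(ab)x$, $1x=x$, $a\mathbf e=\mathbf e$; with an origin $\mathbf 0$ such that $ax\to\mathbf 0$ as $a\downarrow0$ for every $x\ne\mathbf e$; and with a metric $d$ (with values in $[0,\infty]$) that induces the topology and satisfies $d(ax,\mathbf 0)=a\,d(x,\mathbf 0)$. Put $\|x\|=d(x,\mathbf 0)$, $S=\{x:\|x\|=1\}$ and $\mathbb K'=\mathbb K\setminus\{\mathbf 0,\mathbf e\}$. Let $\xi_1,\xi_2,\dots$ be i.i.d. $\mathbb K'$-valued random elements, distributed as $\xi$. Let $\alpha>0$, and let $\sigma$ be a probability measure on $S$ such that for some slowly varying function $L$ $$\lim_{x\to\infty}\frac{x^\alpha}{L(x)}\,\mathbf P\Big\{\frac{\xi}{\|\xi\|}\in B,\ \|\xi\|>x\Big\}=\sigma(B)$$ for all Borel sets $B\subseteq S$ with $\sigma(\partial B)=0$. Suppose that, for some $\beta$ with $\alpha<\beta\le\infty$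 and real $C_1,C_2$, $$\mathbf P\{\|\xi\|>x\}=C_1x^{-\alpha}+C_2x^{-\beta}+o(x^{-\beta})\qquad(x\to\infty),$$ which for $\beta=\infty$ means that $\mathbf P\{\|\xi\|>x\}=C_1x^{-\alpha}$ for all sufficiently large $x$. Let $\zeta=(\beta-\alpha)/\alpha$, where for $\beta=\infty$ we read $\frac{2\zeta}{1+2\zeta}=1$ and $\frac1{1+2\zeta}=0$. Let $(\varepsilon_N)$ be real numbers that converge to some $\varepsilon_0$ with $0\le\varepsilon_0<\frac{2\zeta}{1+2\zeta}$ (for instance $\varepsilon_0=0$, or $\varepsilon_N=\varepsilon_0$ a small positive constant), slowly enough that $N^{\varepsilon_N}\to\infty$ and, if $\beta=\infty$, moreover $N^{\varepsilon_N}/\log N\to\infty$. Let $n=n_N$ and $m=m_N$ be nonnegative integers with $$n\sim N^{\frac{2\zeta}{1+2\zeta}-\varepsilon_N},\qquad m\sim N^{\frac{1}{1+2\zeta}+\varepsilon_N}\qquad(N\to\infty),$$ and for each $N$ choose $n$ pairwise disjoint groups $G_{m,1},\dots,G_{m,n}$, each of $m$ elements (counted by their indices) of the sample $\xi_1,\dots,\xi_N$.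 Let $M^{(1)}_{m,i}$ be the largest norm in $G_{m,i}$, let $M^{(2)}_{m,i}$ be the largest norm in $G_{m,i}$ after one element of norm $M^{(1)}_{m,i}$ has been removed (the maximum of the empty set being $0$), and let $\varkappa_{m,i}=M^{(2)}_{m,i}/M^{(1)}_{m,i}$ and $S_n=\sum_{i=1}^n\varkappa_{m,i}$. Then, as $N\to\infty$, $$\frac{\sqrt n\left(\frac1nS_n-\frac{\alpha}{\alpha+1}\right)}{\left(\frac1n\sum_{i=1}^n\varkappa_{m,i}^2-\left(\frac1nS_n\right)^2\right)^{1/2}}\ \Rightarrow\ \mathcal N(0,1),$$ where the quotient is set to $0$ if its denominator is $0$. -/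

import Mathlib

open MeasureTheory ProbabilityTheory Filter Topology Asymptotics
open scoped ENNReal

/-- A normed cone `K`: an abelian topological semigroup with neutral element `0 : K`, which is a
Polish space, with a jointly continuous multiplication by positive scalars (the laws of
`DistribMulAction` are `a(x+y) = ax+ay`, `a(bx) = (ab)x`, `1x = x`, `ae = e`), with an origin
(which need not be the neutral element), and a metric that may take the value `∞`, induces the
topology and is homogeneous at the origin.  The origin is automatically unique, because `K` is
Hausdorff. -/
class NormedCone (K : Type*) [EMetricSpace K] [AddCommMonoid K]
    [DistribMulAction {a : ℝ // 0 < a} K] extends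
    PolishSpace K, ContinuousAdd K, ContinuousSMul {a : ℝ // 0 < a} K where
  /-- the origin of the cone -/
  origin : K
  tendsto_origin : ∀ x : K, x ≠ 0 →
    Tendsto (fun a : {a : ℝ // 0 < a} => a • x) (comap Subtype.val (𝓝 0)) (𝓝 origin)
  edist_smul_origin : ∀ (a : {a : ℝ // 0 < a}) (x : K),
    edist (a • x) origin = ENNReal.ofReal a * edist x origin

namespace NormedCone

noncomputable section

variable {K : Type*} [EMetricSpace K] [AddCommMonoid K] [DistribMulAction {a : ℝ // 0 < a} K]
  [NormedCone K]

/-- The norm `‖x‖ = d(x, origin)`, with values in `[0, ∞]`. -/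
def coneNorm (x : K) : ℝ≥0∞ := edist x (origin : K)

variable (K) in
/-- The unit sphere `{x | ‖x‖ = 1}`. -/
def unitSphere : Set K := {x | coneNorm x = 1}

variable (K) in
/-- `K' = K \ {origin, neutral element}`. -/
def punctured : Set K := {x | x ≠ origin ∧ x ≠ 0}

open Classical in
/-- The direction `x / ‖x‖` of `x` (with the value `x` if the norm is `0` or `∞`, which does not
happen on `K'`). -/
def direction (x : K) : K :=
  if h : 0 < (coneNorm x).toReal then
    (⟨(coneNorm x).toReal⁻¹, inv_pos.2 h⟩ : {a : ℝ // 0 < a}) • x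
  else x

end

end NormedCone

noncomputable section

open NormedCone

/-- `L` is slowly varying at infinity. -/
def SlowlyVarying (L : ℝ → ℝ) : Prop :=
  ∀ l : ℝ, 0 < l → Tendsto (fun x => L (l * x) / L x) atTop (𝓝 1)

/-- `X ∈ VR(α, σ)`: the random element `X` has a regularly varying tail with exponent `α` and
spectral measure `σ` on the unit sphere. The boundary of `B` is taken in the sphere. -/
def RegularlyVaryingTail {Ω K : Type*} [MeasurableSpace Ω] [EMetricSpace K] [AddCommMonoid K]
    [DistribMulAction {a : ℝ // 0 < a} K] [NormedCone K] [MeasurableSpace K]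
    (μ : Measure Ω) (X : Ω → K) (α : ℝ) (σ : Measure (unitSphere K)) : Prop :=
  ∃ L : ℝ → ℝ, SlowlyVarying L ∧
    ∀ B : Set (unitSphere K), MeasurableSet B → σ (frontier B) = 0 →
      Tendsto (fun x : ℝ => x ^ α / L x *
          μ.real {ω | direction (X ω) ∈ ((↑) '' B : Set K) ∧ ENNReal.ofReal x < coneNorm (X ω)})
        atTop (𝓝 (σ.real B))

/-- `x ^ (-β)` for `x > 1` and an exponent `β` in `(0, ∞]`, with `x ^ (-∞) = 0`. -/
def negPow (β : EReal) (x : ℝ) : ℝ :=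
  if β = ⊤ then 0 else x ^ (-β.toReal)

/-- `P(‖X‖ > x) = C₁ x ^ (-α) + C₂ x ^ (-β) + o(x ^ (-β))` as `x → ∞`. For `β = ∞` this says that
`P(‖X‖ > x) = C₁ x ^ (-α)` for all sufficiently large `x`. -/
def SecondOrderTail {Ω K : Type*} [MeasurableSpace Ω] [EMetricSpace K] [AddCommMonoid K]
    [DistribMulAction {a : ℝ // 0 < a} K] [NormedCone K]
    (μ : Measure Ω) (X : Ω → K) (α : ℝ) (β : EReal) (C₁ C₂ : ℝ) : Prop :=
  (fun x : ℝ => μ.real {ω | ENNReal.ofReal x < coneNorm (X ω)}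
      - C₁ * x ^ (-α) - C₂ * negPow β x) =o[atTop] negPow β

/-- `ζ = (β - α) / α`, for finite `β`. -/
def zeta (α : ℝ) (β : EReal) : ℝ := (β.toReal - α) / α

/-- `2ζ / (1 + 2ζ)`, which is `1` for `β = ∞`. -/
def groupCountExponent (α : ℝ) (β : EReal) : ℝ :=
  if β = ⊤ then 1 else 2 * zeta α β / (1 + 2 * zeta α β)

/-- `1 / (1 + 2ζ)`, which is `0` for `β = ∞`. -/
def groupSizeExponent (α : ℝ) (β : EReal) : ℝ :=
  if β = ⊤ then 0 else 1 / (1 + 2 * zeta α β)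

open Classical in
/-- An index in `s` at which `y` is maximal over `s` (`0` if `s` is empty). -/
def argMax (s : Finset ℕ) (y : ℕ → ℝ≥0∞) : ℕ :=
  if h : s.Nonempty then (s.exists_max_image y h).choose else 0

/-- The largest value `M⁽¹⁾` of `y` over the group `s`. -/
def firstMax (s : Finset ℕ) (y : ℕ → ℝ≥0∞) : ℝ≥0∞ := s.sup y

/-- The second largest value `M⁽²⁾` of `y` over the group `s`: the maximum after one index at
which the maximum is attained has been removed. -/
def secondMax (s : Finset ℕ) (y : ℕ → ℝ≥0∞) : ℝ≥0∞ := (s.erase (argMax s y)).sup y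

/-- The ratio `M⁽²⁾ / M⁽¹⁾` for the norms of the sample `x` in the group `s`. -/
def kappa {K : Type*} [EMetricSpace K] [AddCommMonoid K] [DistribMulAction {a : ℝ // 0 < a} K]
    [NormedCone K] (s : Finset ℕ) (x : ℕ → K) : ℝ :=
  (secondMax s (fun j => coneNorm (x j)) / firstMax s (fun j => coneNorm (x j))).toReal

/-- `√n (S / n - c) / ((1/n) ∑ kᵢ² - (S / n)²) ^ (1/2)` with `S = ∑ kᵢ`. -/
def selfNormalized {n : ℕ} (k : Fin n → ℝ) (c : ℝ) : ℝ :=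
  √(n : ℝ) * ((∑ i, k i) / n - c) / √((∑ i, k i ^ 2) / n - ((∑ i, k i) / n) ^ 2)

end

/-! For an exact Pareto law of the norms, `κ ^ α` is uniform on `[0, 1]` for every group of size at
least two, so `E κ ^ p = α / (α + p)`. The cases `p = 1, 2` give the centring constant and a
positive limiting variance. Ratios of disjoint groups are independent and lie in `[0, 1]`, so the
theorem reduces to showing that the bias of these moments is `o(1/√n)`: a central limit theorem for
bounded triangular arrays, a weak law for the empirical variance and Slutsky's lemma then finish
(`tendstoInDistribution_selfNormalized`).

The bias bound is `abs_integral_ratio_pow_sub_le`. Let `Xᵢ` be the norms in a group and `Yᵢ` the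
maximum of the others. Pointwise, `1 - κ ^ p` is the sum over `i` of `1 - (Yᵢ / Xᵢ) ^ p` restricted
to `Yᵢ < Xᵢ`, since only the index of the maximum can contribute. Given `Yᵢ = y`, the mean of the
summand is `∫₀¹ P(X > y (1 - t) ^ (-1/p)) dt`, which for a tail close to `C x ^ (-α)` is close to `p
/ (α + p) * P(X > y)`. The probabilities that `Xᵢ` is the maximum add up to `1` apart from ties, so
`E (1 - κ ^ p)` is close to `p / (α + p)`.

Each of the `m` summands has an error of order `E Yᵢ ^ (-β)`, up to an exponentially small term. As
`P(Yᵢ ≤ x) ≤ exp(-(m - 1) c x ^ (-α))`, this is of order `m ^ (-β/α)`, and the total bias is of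
order `m ^ (-ζ)`. The exponents of `n` and `m` are balanced so that `√n * m ^ (-ζ)` is of order `(N
^ ε) ^ (-(1/2 + ζ))`, which tends to `0`. For `β = ∞` only the exponential term remains, and `m /
log N → ∞` disposes of it.

Regular variation enters only through the norm: it forces `C₁ > 0`, hence the lower bound `c x ^
(-α)` of the tail. -/

/-! ### Characteristic functions and the central limit theorem for bounded arrays -/

theorem norm_prod_sub_prod_le_sum {ι : Type*} (s : Finset ι) (f g : ι → ℂ)
    (hf : ∀ i ∈ s, ‖f i‖ ≤ 1) (hg : ∀ i ∈ s, ‖g i‖ ≤ 1) :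
    ‖∏ i ∈ s, f i - ∏ i ∈ s, g i‖ ≤ ∑ i ∈ s, ‖f i - g i‖ := by
  classical
  induction s using Finset.induction_on with
  | empty => simp
  | insert a s ha ih =>
    rw [Finset.prod_insert ha, Finset.prod_insert ha, Finset.sum_insert ha]
    have h1 : f a * ∏ i ∈ s, f i - g a * ∏ i ∈ s, g i =
        (f a - g a) * ∏ i ∈ s, f i + g a * (∏ i ∈ s, f i - ∏ i ∈ s, g i) := by ring
    have h2 : ‖∏ i ∈ s, f i‖ ≤ 1 := by
      rw [norm_prod]
      exact Finset.prod_le_one (fun _ _ => norm_nonneg _)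
        fun i hi => hf i (Finset.mem_insert_of_mem hi)
    have h3 := ih (fun i hi => hf i (Finset.mem_insert_of_mem hi))
      (fun i hi => hg i (Finset.mem_insert_of_mem hi))
    rw [h1]
    refine (norm_add_le _ _).trans (add_le_add ?_ ?_)
    · rw [norm_mul]
      exact mul_le_of_le_one_right (norm_nonneg _) h2
    · rw [norm_mul]
      exact (mul_le_of_le_one_left (norm_nonneg _) (hg a (Finset.mem_insert_self _ _))).trans h3

theorem norm_exp_I_mul_sub_quadratic_le {x : ℝ} (hx : |x| ≤ 1) :
    ‖Complex.exp (x * Complex.I) - (1 + x * Complex.I - x ^ 2 / 2)‖ ≤ |x| ^ 3 := by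
  have hn : ‖(x : ℂ) * Complex.I‖ = |x| := by simp
  have h := Complex.exp_bound (x := (x : ℂ) * Complex.I) (by rw [hn]; exact hx) (n := 3) (by norm_num)
  have e : ∑ m ∈ Finset.range 3, ((x : ℂ) * Complex.I) ^ m / (m.factorial : ℂ) =
      1 + x * Complex.I - x ^ 2 / 2 := by
    simp [Finset.sum_range_succ, mul_pow, Complex.I_sq]
    ring
  rw [e, hn] at h
  refine h.trans (mul_le_of_le_one_right (by positivity) ?_)
  norm_num [Nat.factorial]

theorem abs_exp_sub_linear_le {x : ℝ} (hx : |x| ≤ 1) :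
    |Real.exp x - (1 + x)| ≤ x ^ 2 := by
  have := Real.abs_exp_sub_one_sub_id_le hx
  rwa [sub_sub] at this

section Bounded

variable {Ω : Type*} [MeasurableSpace Ω] {μ : Measure Ω} [IsProbabilityMeasure μ]

theorem norm_charFun_sub_quadratic_le {Z : Ω → ℝ} (hZ : Measurable Z) (hb : ∀ ω, |Z ω| ≤ 1)
    {s : ℝ} (hs : |s| ≤ 1) :
    ‖charFun (μ.map Z) s -
      (1 + s * (∫ ω, Z ω ∂μ : ℝ) * Complex.I - s ^ 2 / 2 * (∫ ω, Z ω ^ 2 ∂μ : ℝ))‖ ≤ |s| ^ 3 := by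
  have hsZ : ∀ ω, |s * Z ω| ≤ |s| := fun ω => by
    rw [abs_mul]; exact mul_le_of_le_one_right (abs_nonneg _) (hb ω)
  have i1 : Integrable Z μ := .of_bound hZ.aestronglyMeasurable 1 (ae_of_all _ hb)
  have i2 : Integrable (fun ω => Z ω ^ 2) μ :=
    .of_bound (hZ.pow_const 2).aestronglyMeasurable 1 (ae_of_all _ fun ω => by
      rw [norm_pow]; exact pow_le_one₀ (norm_nonneg _) (hb ω))
  have i0 : Integrable (fun ω => Complex.exp ((s * Z ω : ℝ) * Complex.I)) μ := by
    refine .of_bound (by fun_prop) 1 (ae_of_all _ fun ω => ?_)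
    rw [Complex.norm_exp_ofReal_mul_I]
  have i1' : Integrable (fun ω => (s : ℂ) * (Z ω : ℂ) * Complex.I) μ :=
    (i1.ofReal.const_mul _).mul_const _
  have i2' : Integrable (fun ω => (s : ℂ) ^ 2 / 2 * ((Z ω ^ 2 : ℝ) : ℂ)) μ :=
    i2.ofReal.const_mul _
  have e : charFun (μ.map Z) s -
      (1 + s * (∫ ω, Z ω ∂μ : ℝ) * Complex.I - s ^ 2 / 2 * (∫ ω, Z ω ^ 2 ∂μ : ℝ)) =
      ∫ ω, (Complex.exp ((s * Z ω : ℝ) * Complex.I) -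
        (1 + (s : ℂ) * (Z ω : ℂ) * Complex.I - (s : ℂ) ^ 2 / 2 * ((Z ω ^ 2 : ℝ) : ℂ))) ∂μ := by
    have i3 : Integrable (fun ω => 1 + (s : ℂ) * (Z ω : ℂ) * Complex.I) μ :=
      (integrable_const _).add i1'
    have i4 : Integrable (fun ω => 1 + (s : ℂ) * (Z ω : ℂ) * Complex.I -
        (s : ℂ) ^ 2 / 2 * ((Z ω ^ 2 : ℝ) : ℂ)) μ := i3.sub i2'
    rw [integral_sub i0 i4, integral_sub i3 i2', integral_add (integrable_const _) i1',
      integral_mul_const, integral_const_mul, integral_const_mul, integral_complex_ofReal,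
      integral_complex_ofReal,
      charFun_apply_real, integral_map hZ.aemeasurable (by fun_prop)]
    simp
  rw [e]
  refine (norm_integral_le_of_norm_le_const (C := |s| ^ 3) (ae_of_all _ fun ω => ?_)).trans
    (by simp)
  have h := norm_exp_I_mul_sub_quadratic_le ((hsZ ω).trans hs)
  refine le_trans (le_of_eq ?_) (h.trans (pow_le_pow_left₀ (abs_nonneg _) (hsZ ω) 3))
  congr 2
  push_cast
  ring

/-- Both sides are compared with their expansions to second order in `s`. The cubic term counts
twice: once for the Taylor remainder of the characteristic function and once for that of the
exponential, which is at most `s ^ 4 ≤ |s| ^ 3`. -/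
theorem norm_charFun_sub_exp_le {Z : Ω → ℝ} (hZ : Measurable Z) (hb : ∀ ω, |Z ω| ≤ 1)
    {s v δ η : ℝ} (hs : |s| ≤ 1) (hv : 0 ≤ v) (hv1 : v ≤ 1) (h1 : |∫ ω, Z ω ∂μ| ≤ δ)
    (h2 : |∫ ω, Z ω ^ 2 ∂μ - v| ≤ η) :
    ‖charFun (μ.map Z) s - Real.exp (-(s ^ 2 * v / 2))‖ ≤
      |s| * δ + s ^ 2 * η + 2 * |s| ^ 3 := by
  have hc := norm_charFun_sub_quadratic_le hZ hb hs (μ := μ)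
  set a := ∫ ω, Z ω ∂μ
  set b := ∫ ω, Z ω ^ 2 ∂μ
  have hs2 : s ^ 2 ≤ 1 := by rw [← sq_abs]; exact pow_le_one₀ (abs_nonneg _) hs
  have hsv : s ^ 2 * v ≤ s ^ 2 := mul_le_of_le_one_right (sq_nonneg _) hv1
  have hsv0 : 0 ≤ s ^ 2 * v := by positivity
  have he := abs_exp_sub_linear_le (x := -(s ^ 2 * v / 2))
    (by rw [abs_neg, abs_of_nonneg (by positivity)]; linarith)
  have he' : (-(s ^ 2 * v / 2)) ^ 2 ≤ |s| ^ 3 := by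
    have h4 : (-(s ^ 2 * v / 2)) ^ 2 ≤ (s ^ 2) ^ 2 := by
      rw [neg_sq]; exact pow_le_pow_left₀ (by positivity) (by linarith) 2
    refine h4.trans ?_
    rw [← sq_abs s, ← pow_mul]
    exact pow_le_pow_of_le_one (abs_nonneg _) hs (by norm_num)
  have e : charFun (μ.map Z) s - Real.exp (-(s ^ 2 * v / 2)) =
      (charFun (μ.map Z) s - (1 + s * (a : ℝ) * Complex.I - s ^ 2 / 2 * (b : ℝ))) +
      ((s * a : ℝ) * Complex.I + ((-(s ^ 2 / 2 * (b - v)) : ℝ) : ℂ)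
        + ((-(Real.exp (-(s ^ 2 * v / 2)) - (1 + -(s ^ 2 * v / 2))) : ℝ) : ℂ)) := by
    push_cast; ring
  rw [e]
  refine (norm_add_le _ _).trans ?_
  have n1 : ‖((s * a : ℝ) : ℂ) * Complex.I‖ ≤ |s| * δ := by
    rw [norm_mul, Complex.norm_I, mul_one, Complex.norm_real, Real.norm_eq_abs, abs_mul]
    gcongr
  have n2 : ‖((-(s ^ 2 / 2 * (b - v)) : ℝ) : ℂ)‖ ≤ s ^ 2 * η := by
    rw [Complex.norm_real, Real.norm_eq_abs, abs_neg, abs_mul, abs_of_nonneg (by positivity)]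
    have : 0 ≤ η := (abs_nonneg _).trans h2
    gcongr
    linarith [sq_nonneg s]
  have n3 : ‖((-(Real.exp (-(s ^ 2 * v / 2)) - (1 + -(s ^ 2 * v / 2))) : ℝ) : ℂ)‖ ≤ |s| ^ 3 := by
    rw [Complex.norm_real, Real.norm_eq_abs, abs_neg]
    exact he.trans he'
  have n4 := norm_add₃_le (a := ((s * a : ℝ) : ℂ) * Complex.I)
    (b := ((-(s ^ 2 / 2 * (b - v)) : ℝ) : ℂ))
    (c := ((-(Real.exp (-(s ^ 2 * v / 2)) - (1 + -(s ^ 2 * v / 2))) : ℝ) : ℂ))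
  linarith

/-- **Central limit theorem** for the rows of a triangular array of uniformly bounded independent
random variables, whose means are `o(1/√k)` and whose second moments converge to `v`. -/
theorem tendstoInDistribution_sum_of_bounded {k : ℕ → ℕ} (hk : Tendsto k atTop atTop)
    {Z : (N : ℕ) → Fin (k N) → Ω → ℝ} (hZ : ∀ N i, Measurable (Z N i))
    (hind : ∀ N, iIndepFun (Z N) μ) (hb : ∀ N i ω, |Z N i ω| ≤ 1) {δ η : ℕ → ℝ} {v : ℝ}
    (hv : 0 ≤ v) (hv1 : v ≤ 1) (h1 : ∀ᶠ N in atTop, ∀ i, |∫ ω, Z N i ω ∂μ| ≤ δ N)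
    (hδ : Tendsto (fun N => √(k N) * δ N) atTop (𝓝 0))
    (h2 : ∀ᶠ N in atTop, ∀ i, |∫ ω, Z N i ω ^ 2 ∂μ - v| ≤ η N)
    (hη : Tendsto η atTop (𝓝 0)) :
    TendstoInDistribution (fun N ω => (√(k N))⁻¹ * ∑ i, Z N i ω) atTop id (fun _ => μ)
      (gaussianReal 0 v.toNNReal) where
  forall_aemeasurable N := by
    have := hZ N
    fun_prop
  tendsto := by
    refine ProbabilityMeasure.tendsto_iff_tendsto_charFun.2 fun t ↦ ?_
    have hsq : Tendsto (fun N => √(k N : ℝ)) atTop atTop :=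
      Real.tendsto_sqrt_atTop.comp (tendsto_natCast_atTop_atTop.comp hk)
    simp only [ProbabilityMeasure.coe_mk, Measure.map_id, charFun_gaussianReal]
    -- Both characteristic functions are products of `k` factors at `s = t / √k`. The product
    -- difference is at most the sum of the factor differences, that is `k (|s| δ + s² η + 2 |s|³)`.
    have hmain : ∀ᶠ N in atTop, ‖charFun (μ.map fun ω => (√(k N))⁻¹ * ∑ i, Z N i ω) t -
        Real.exp (-(t ^ 2 * v / 2))‖ ≤
        |t| * (√(k N) * δ N) + t ^ 2 * η N + 2 * |t| ^ 3 * (√(k N))⁻¹ := by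
      filter_upwards [h1, h2, hsq.eventually_ge_atTop (max 1 |t|)] with N h1 h2 h3
      have hkk : (√(k N : ℝ)) ^ 2 = k N := Real.sq_sqrt (Nat.cast_nonneg _)
      set r := √(k N : ℝ)
      have hpos : 0 < r := lt_of_lt_of_le one_pos ((le_max_left _ _).trans h3)
      have hs : |r⁻¹ * t| ≤ 1 := by
        rw [abs_mul, abs_inv, abs_of_pos hpos, inv_mul_le_iff₀ hpos, mul_one]
        exact (le_max_right _ _).trans h3
      have ha : charFun (μ.map fun ω => (r)⁻¹ * ∑ i, Z N i ω) t =
          ∏ i, charFun (μ.map (Z N i)) ((r)⁻¹ * t) := by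
        rw [charFun_map_mul_comp (by have := hZ N; fun_prop),
          (hind N).charFun_map_fun_sum_eq_prod (fun i => (hZ N i).aemeasurable), Finset.prod_apply]
      have hb' : ((Real.exp (-(t ^ 2 * v / 2)) : ℝ) : ℂ) =
          ∏ i : Fin (k N), ((Real.exp (-(((r)⁻¹ * t) ^ 2 * v / 2)) : ℝ) : ℂ) := by
        rw [Finset.prod_const, Finset.card_univ, Fintype.card_fin, ← Complex.ofReal_pow,
          ← Real.exp_nat_mul]
        congr 2
        clear_value r
        rw [← hkk]
        field_simp
      rw [ha, hb']
      refine (norm_prod_sub_prod_le_sum _ _ _ (fun i _ => ?_) fun i _ => ?_).trans ?_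
      · have : IsProbabilityMeasure (μ.map (Z N i)) :=
          Measure.isProbabilityMeasure_map (hZ N i).aemeasurable
        exact norm_charFun_le_one _
      · rw [Complex.norm_real, Real.norm_eq_abs, Real.abs_exp, Real.exp_le_one_iff]
        have : 0 ≤ ((r)⁻¹ * t) ^ 2 * v / 2 := by positivity
        linarith
      refine (Finset.sum_le_sum fun i _ =>
        norm_charFun_sub_exp_le (hZ N i) (hb N i) hs hv hv1 (h1 i) (h2 i)).trans (le_of_eq ?_)
      clear_value r
      rw [Finset.sum_const, Finset.card_univ, Fintype.card_fin, nsmul_eq_mul, ← hkk, abs_mul,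
        abs_of_pos (inv_pos.2 hpos)]
      field_simp
    rw [tendsto_iff_norm_sub_tendsto_zero]
    have hlim : Tendsto (fun N => |t| * (√(k N) * δ N) + t ^ 2 * η N +
        2 * |t| ^ 3 * (√(k N))⁻¹) atTop (𝓝 0) := by
      have := ((hδ.const_mul |t|).add (hη.const_mul (t ^ 2))).add
        (hsq.inv_tendsto_atTop.const_mul (2 * |t| ^ 3))
      simpa using this
    refine squeeze_zero' (Eventually.of_forall fun _ => norm_nonneg _) ?_ hlim
    filter_upwards [hmain] with N hN
    refine le_trans (le_of_eq ?_) hN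
    congr 2
    rw [Complex.ofReal_exp]
    congr 1
    simp [Real.coe_toNNReal _ hv]
    ring

end Bounded

/-! ### Weak law of large numbers and self-normalization -/

theorem tendstoInMeasure_variance_of_moments {Ω : Type*} [MeasurableSpace Ω] {μ : Measure Ω}
    {X Y : ℕ → Ω → ℝ} {c d : ℝ}
    (hc : c ∈ Set.Icc (0 : ℝ) 1)
    (hXb : ∀ N ω, X N ω ∈ Set.Icc (0 : ℝ) 1)
    (hX : TendstoInMeasure μ X atTop fun _ => c) (hY : TendstoInMeasure μ Y atTop fun _ => d) :
    TendstoInMeasure μ (fun N ω => Y N ω - X N ω ^ 2) atTop fun _ => d - c ^ 2 := by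
  rw [tendstoInMeasure_iff_norm] at hX hY ⊢
  intro ε hε
  -- Since `X + c ≤ 2`, the error of `X ^ 2` is at most twice that of `X`, hence `ε / 4` against `ε
  -- / 2`.
  have hlim := (hX (ε / 4) (by positivity)).add (hY (ε / 2) (by positivity))
  rw [add_zero] at hlim
  refine tendsto_of_tendsto_of_tendsto_of_le_of_le tendsto_const_nhds hlim
    (fun _ => zero_le) fun N => (measure_mono fun ω hω => ?_).trans (measure_union_le _ _)
  simp only [Set.mem_ofPred_eq, Real.norm_eq_abs, Set.mem_union] at hω ⊢
  by_contra! h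
  have e : Y N ω - X N ω ^ 2 - (d - c ^ 2) = (Y N ω - d) - (X N ω - c) * (X N ω + c) := by ring
  have h3 : |(X N ω - c) * (X N ω + c)| ≤ |X N ω - c| * 2 := by
    rw [abs_mul]
    have := hXb N ω
    gcongr
    rw [abs_of_nonneg (add_nonneg this.1 hc.1)]
    linarith [this.2, hc.2]
  have := abs_sub (Y N ω - d) ((X N ω - c) * (X N ω + c))
  rw [e] at hω
  linarith

section SelfNormalized

variable {Ω : Type*} [MeasurableSpace Ω] {μ : Measure Ω} [IsProbabilityMeasure μ]

/-- **Weak law of large numbers** for the rows of a triangular array of independent random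
variables with values in `[0, 1]`, whose means converge to `b`. -/
theorem tendstoInMeasure_average_of_bounded {k : ℕ → ℕ} (hk : Tendsto k atTop atTop)
    {W : (N : ℕ) → Fin (k N) → Ω → ℝ} (hW : ∀ N i, Measurable (W N i))
    (hind : ∀ N, iIndepFun (W N) μ) (hb : ∀ N i ω, W N i ω ∈ Set.Icc (0 : ℝ) 1) {η : ℕ → ℝ} {b : ℝ}
    (h1 : ∀ᶠ N in atTop, ∀ i, |∫ ω, W N i ω ∂μ - b| ≤ η N) (hη : Tendsto η atTop (𝓝 0)) :
    TendstoInMeasure μ (fun N ω => (∑ i, W N i ω) / k N) atTop (fun _ => b) := by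
  rw [tendstoInMeasure_iff_norm]
  intro ε hε
  have hkR : Tendsto (fun N => (k N : ℝ)) atTop atTop := tendsto_natCast_atTop_atTop.comp hk
  have hlim : Tendsto (fun N => ENNReal.ofReal (4 / ε ^ 2 * (k N : ℝ)⁻¹)) atTop (𝓝 0) := by
    have := ENNReal.tendsto_ofReal (hkR.inv_tendsto_atTop.const_mul (4 / ε ^ 2))
    simpa using this
  refine tendsto_of_tendsto_of_tendsto_of_le_of_le' tendsto_const_nhds hlim
    (Eventually.of_forall fun _ => zero_le) ?_
  filter_upwards [h1, hη.eventually_le_const (half_pos hε), hkR.eventually_gt_atTop 0]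
    with N h1 h2 hk0
  have hLp : ∀ i, MemLp (W N i) 2 μ := fun i =>
    MemLp.of_bound (hW N i).aestronglyMeasurable 1 (ae_of_all _ fun ω => by
      rw [Real.norm_eq_abs, abs_of_nonneg (hb N i ω).1]; exact (hb N i ω).2)
  have hSLp : MemLp (∑ i, W N i) 2 μ := memLp_finsetSum' _ fun i _ => hLp i
  have hvar : variance (∑ i, W N i) μ ≤ k N := by
    rw [IndepFun.variance_sum (fun i _ => hLp i) (fun i _ j _ hij => (hind N).indepFun hij)]
    refine (Finset.sum_le_sum fun i _ => (variance_le_sq_of_bounded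
      (ae_of_all _ (hb N i)) (hW N i).aemeasurable).trans (by norm_num : _ ≤ (1 : ℝ))).trans ?_
    simp
  have hmean : |∫ ω, (∑ i, W N i) ω ∂μ - k N * b| ≤ k N * (ε / 2) := by
    simp only [Finset.sum_apply]
    rw [integral_finsetSum _ fun i _ => (hLp i).integrable (by norm_num)]
    have : ∑ i, ∫ ω, W N i ω ∂μ - k N * b = ∑ i, (∫ ω, W N i ω ∂μ - b) := by
      rw [Finset.sum_sub_distrib]; simp
    rw [this]
    refine (Finset.abs_sum_le_sum_abs _ _).trans
      ((Finset.sum_le_sum fun i _ => (h1 i).trans h2).trans ?_)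
    simp
  -- Half of the deviation `k ε` is left to the bias; Chebyshev's inequality with variance at most
  -- `k` handles the other half.
  have hc : 0 < k N * (ε / 2) := by positivity
  refine le_trans (measure_mono fun ω hω => ?_) ((meas_ge_le_variance_div_sq hSLp hc).trans
    (ENNReal.ofReal_le_ofReal ?_))
  · simp only [Set.mem_ofPred_eq, Real.norm_eq_abs] at hω ⊢
    have e : (∑ i, W N i ω) / k N - b = ((∑ i, W N i) ω - k N * b) / k N := by
      rw [Finset.sum_apply]; field_simp
    rw [e, abs_div, abs_of_pos hk0, le_div_iff₀ hk0] at hω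
    have := abs_sub_le ((∑ i, W N i) ω) (∫ ω, (∑ i, W N i) ω ∂μ) (k N * b)
    linarith
  · rw [div_le_iff₀ (by positivity)]
    refine hvar.trans (le_of_eq ?_)
    field_simp
    norm_num

/-- The self-normalized central limit theorem for the rows of a triangular array of independent
random variables with values in `[0, 1]`. -/
theorem tendstoInDistribution_selfNormalized {k : ℕ → ℕ} (hk : Tendsto k atTop atTop)
    {W : (N : ℕ) → Fin (k N) → Ω → ℝ} (hW : ∀ N i, Measurable (W N i))
    (hind : ∀ N, iIndepFun (W N) μ) (hb : ∀ N i ω, W N i ω ∈ Set.Icc (0 : ℝ) 1)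
    {δ η : ℕ → ℝ} {c d : ℝ} (hc : c ∈ Set.Icc (0 : ℝ) 1) (hd : d ≤ 1) (hcd : c ^ 2 < d)
    (h1 : ∀ᶠ N in atTop, ∀ i, |∫ ω, W N i ω ∂μ - c| ≤ δ N)
    (hδ : Tendsto (fun N => √(k N) * δ N) atTop (𝓝 0)) (hδ0 : Tendsto δ atTop (𝓝 0))
    (h2 : ∀ᶠ N in atTop, ∀ i, |∫ ω, W N i ω ^ 2 ∂μ - d| ≤ η N)
    (hη : Tendsto η atTop (𝓝 0)) :
    TendstoInDistribution (fun N ω => selfNormalized (fun i => W N i ω) c) atTop id (fun _ => μ)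
      (gaussianReal 0 1) := by
  set v := d - c ^ 2 with hvdef
  have hv : 0 < v := sub_pos.2 hcd
  have hv1 : v ≤ 1 := by have := sq_nonneg c; linarith
  have hWi : ∀ N i, Integrable (W N i) μ := fun N i =>
    .of_bound (hW N i).aestronglyMeasurable 1 (ae_of_all _ fun ω => by
      rw [Real.norm_eq_abs, abs_of_nonneg (hb N i ω).1]; exact (hb N i ω).2)
  have hW2b : ∀ N i ω, W N i ω ^ 2 ∈ Set.Icc (0 : ℝ) 1 := fun N i ω =>
    ⟨sq_nonneg _, pow_le_one₀ (hb N i ω).1 (hb N i ω).2⟩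
  have hW2i : ∀ N i, Integrable (fun ω => W N i ω ^ 2) μ := fun N i =>
    .of_bound ((hW N i).pow_const 2).aestronglyMeasurable 1 (ae_of_all _ fun ω => by
      rw [Real.norm_eq_abs, abs_of_nonneg (hW2b N i ω).1]; exact (hW2b N i ω).2)
  have hm1 : ∀ N i, ∫ ω, (W N i ω - c) ∂μ = ∫ ω, W N i ω ∂μ - c := fun N i => by
    rw [integral_sub (hWi N i) (integrable_const _)]; simp
  have hm2 : ∀ N i, ∫ ω, (W N i ω - c) ^ 2 ∂μ =
      ∫ ω, W N i ω ^ 2 ∂μ - 2 * c * ∫ ω, W N i ω ∂μ + c ^ 2 := fun N i => by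
    have e : ∀ ω, (W N i ω - c) ^ 2 = W N i ω ^ 2 - 2 * c * W N i ω + c ^ 2 := fun ω => by ring
    have i3 : Integrable (fun ω => W N i ω ^ 2 - 2 * c * W N i ω) μ :=
      (hW2i N i).sub ((hWi N i).const_mul _)
    simp_rw [e]
    rw [integral_add i3 (integrable_const _), integral_sub (hW2i N i) ((hWi N i).const_mul _),
      integral_const_mul]
    simp
  have hclt := tendstoInDistribution_sum_of_bounded (μ := μ) hk (Z := fun N i ω => W N i ω - c)
    (fun N i => (hW N i).sub_const c)
    (fun N => (hind N).comp (fun _ x => x - c) fun _ => by fun_prop)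
    (fun N i ω => abs_le.2 ⟨by linarith [(hb N i ω).1, hc.2], by linarith [(hb N i ω).2, hc.1]⟩)
    (δ := δ) (η := fun N => η N + 2 * δ N) hv.le hv1
    (by filter_upwards [h1] with N h i; rw [hm1]; exact h i) hδ
    (by
      filter_upwards [h1, h2] with N h h' i
      rw [hm2]
      have e : ∫ ω, W N i ω ^ 2 ∂μ - 2 * c * ∫ ω, W N i ω ∂μ + c ^ 2 - v =
        (∫ ω, W N i ω ^ 2 ∂μ - d) - 2 * c * (∫ ω, W N i ω ∂μ - c) := by rw [hvdef]; ring
      rw [e]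
      refine (abs_sub _ _).trans (add_le_add (h' i) ?_)
      rw [abs_mul, abs_of_nonneg (mul_nonneg zero_le_two hc.1)]
      have := hc.2
      gcongr
      · linarith
      · exact h i)
    (by simpa using hη.add (hδ0.const_mul 2))
  set D : ℕ → Ω → ℝ := fun N ω => (∑ i, W N i ω ^ 2) / k N - ((∑ i, W N i ω) / k N) ^ 2
  have hDm : ∀ N, Measurable (D N) := fun N => by have := hW N; fun_prop
  have hD : TendstoInMeasure μ D atTop fun _ => v :=
    tendstoInMeasure_variance_of_moments hc
      (fun N ω => ⟨div_nonneg (Finset.sum_nonneg fun i _ => (hb N i ω).1) (Nat.cast_nonneg _),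
        div_le_one_of_le₀ ((Finset.sum_le_sum fun i _ => (hb N i ω).2).trans (by simp))
          (Nat.cast_nonneg _)⟩)
      (tendstoInMeasure_average_of_bounded hk hW hind hb h1 hδ0)
      (tendstoInMeasure_average_of_bounded hk (fun N i => (hW N i).pow_const 2)
        (fun N => (hind N).comp (fun _ x => x ^ 2) fun _ => by fun_prop) hW2b h2 hη)
  -- The quotient by `√y` is not continuous at `y = 0`. With the empirical variance truncated below
  -- at `v / 2`, Slutsky's lemma applies; the truncated and the original statistic differ only where
  -- `D` is at distance at least `v / 2` from its limit `v`.
  have hg : Continuous fun p : ℝ × ℝ => p.1 / √(max p.2 (v / 2)) := by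
    refine continuous_fst.div (by fun_prop) fun p => (Real.sqrt_pos.2 ?_).ne'
    exact lt_max_of_lt_right (half_pos hv)
  have hs := hclt.continuous_comp_prodMk_of_tendstoInMeasure_const hg hD
    fun N => (hDm N).aemeasurable
  have hsN : TendstoInDistribution (fun N ω => ((√(k N))⁻¹ * ∑ i, (W N i ω - c)) /
      √(max (D N ω) (v / 2))) atTop id (fun _ => μ) (gaussianReal 0 1) := by
    refine ⟨hs.forall_aemeasurable, by fun_prop, ?_⟩
    convert hs.tendsto using 2
    refine congrArg 𝓝 (Subtype.ext ?_)
    have e : (fun ω : ℝ => id ω / √(max v (v / 2))) = (· / √v) := by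
      ext; simp [max_eq_left (half_le_self hv.le)]
    simp only [e]
    rw [gaussianReal_map_div_const, Measure.map_id]
    congr 1
    · simp
    · ext
      simp [Real.sq_sqrt hv.le, Real.coe_toNNReal _ hv.le, hv.ne']
  have hT : ∀ N ω, (√(k N))⁻¹ * ∑ i, (W N i ω - c) = √(k N) * ((∑ i, W N i ω) / k N - c) := by
    intro N ω
    rcases Nat.eq_zero_or_pos (k N) with h0 | h0
    · have : √(k N : ℝ) = 0 := by simp [h0]
      simp [this]
    have hpos : (0 : ℝ) < k N := Nat.cast_pos.2 h0
    have hp : 0 < √(k N : ℝ) := Real.sqrt_pos.2 hpos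
    have hkk : (√(k N : ℝ)) ^ 2 = k N := Real.sq_sqrt hpos.le
    rw [Finset.sum_sub_distrib, Finset.sum_const, Finset.card_univ, Fintype.card_fin, nsmul_eq_mul]
    field_simp
    rw [hkk]
  refine tendstoInDistribution_of_tendstoInMeasure_sub _ _ hsN ?_ fun N => ?_
  · rw [tendstoInMeasure_iff_norm] at hD ⊢
    intro ε hε
    refine tendsto_of_tendsto_of_tendsto_of_le_of_le tendsto_const_nhds (hD (v / 2) (half_pos hv))
      (fun _ => zero_le) fun N => measure_mono fun ω hω => ?_
    simp only [Set.mem_ofPred_eq, Pi.sub_apply, Pi.zero_apply, sub_zero, Real.norm_eq_abs] at hω ⊢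
    by_contra! h
    have h5 : v / 2 ≤ D N ω := by linarith [(abs_lt.1 h).1]
    rw [max_eq_left h5, hT N ω] at hω
    simp only [selfNormalized, D, sub_self, abs_zero] at hω
    linarith
  · have := hW N
    unfold selfNormalized
    fun_prop

end SelfNormalized

/-! ### The two largest values of a finite sample -/

theorem argMax_mem {s : Finset ℕ} (hs : s.Nonempty) (y : ℕ → ℝ≥0∞) : argMax s y ∈ s := by
  rw [argMax, dif_pos hs]
  exact (s.exists_max_image y hs).choose_spec.1

theorem le_argMax {s : Finset ℕ} {y : ℕ → ℝ≥0∞} {j : ℕ} (hj : j ∈ s) : y j ≤ y (argMax s y) := by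
  rw [argMax, dif_pos ⟨j, hj⟩]
  exact (s.exists_max_image y ⟨j, hj⟩).choose_spec.2 j hj

theorem firstMax_eq {s : Finset ℕ} (hs : s.Nonempty) (y : ℕ → ℝ≥0∞) :
    firstMax s y = y (argMax s y) :=
  le_antisymm (Finset.sup_le fun _ hj => le_argMax hj) (Finset.le_sup (argMax_mem hs y))

theorem secondMax_le_firstMax (s : Finset ℕ) (y : ℕ → ℝ≥0∞) : secondMax s y ≤ firstMax s y :=
  Finset.sup_mono (Finset.erase_subset _ _)

theorem le_sup_erase {s : Finset ℕ} {y : ℕ → ℝ≥0∞} {i : ℕ} (hi : i ∈ s) (h : i ≠ argMax s y) :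
    y (argMax s y) ≤ (s.erase i).sup y :=
  Finset.le_sup (f := y) (Finset.mem_erase.2 ⟨h.symm, argMax_mem ⟨i, hi⟩ y⟩)

theorem secondMax_le_sup_erase {s : Finset ℕ} {y : ℕ → ℝ≥0∞} {i : ℕ} (hi : i ∈ s) :
    secondMax s y ≤ (s.erase i).sup y := by
  by_cases h : i = argMax s y
  · rw [h]; rfl
  · refine (secondMax_le_firstMax s y).trans ?_
    rw [firstMax_eq ⟨i, hi⟩]
    exact le_sup_erase hi h

/-- Removing a maximal element lowers the maximum the most. The formula does not mention the chosen
index, which makes measurability evident. -/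
theorem secondMax_eq_inf' {s : Finset ℕ} (hs : s.Nonempty) (y : ℕ → ℝ≥0∞) :
    secondMax s y = s.inf' hs fun i => (s.erase i).sup y :=
  le_antisymm (Finset.le_inf' _ _ fun _ hi => secondMax_le_sup_erase hi)
    (Finset.inf'_le _ (argMax_mem hs y))

/-- The function `1 - (a / b) ^ p` of `a < b`, extended by `0`. -/
noncomputable def gap (p : ℕ) (a b : ℝ≥0∞) : ℝ := if a < b then 1 - (a / b).toReal ^ p else 0

theorem gap_of_le {p : ℕ} {a b : ℝ≥0∞} (h : b ≤ a) : gap p a b = 0 := if_neg h.not_gt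

theorem toReal_div_mem_Icc {a b : ℝ≥0∞} (h : a ≤ b) : (a / b).toReal ∈ Set.Icc (0 : ℝ) 1 := by
  refine ⟨ENNReal.toReal_nonneg, ENNReal.toReal_le_of_le_ofReal zero_le_one ?_⟩
  rw [ENNReal.ofReal_one]
  exact (ENNReal.div_le_div_right h b).trans ENNReal.div_self_le_one

theorem gap_mem_Icc (p : ℕ) (a b : ℝ≥0∞) : gap p a b ∈ Set.Icc (0 : ℝ) 1 := by
  unfold gap
  split_ifs with h
  · have := toReal_div_mem_Icc h.le
    exact ⟨sub_nonneg.2 (pow_le_one₀ this.1 this.2), sub_le_self _ (pow_nonneg this.1 _)⟩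
  · simp

theorem measurable_gap (p : ℕ) : Measurable fun x : ℝ≥0∞ × ℝ≥0∞ => gap p x.1 x.2 := by
  unfold gap
  refine Measurable.ite (measurableSet_lt measurable_fst measurable_snd) ?_ measurable_const
  exact measurable_const.sub ((measurable_fst.div measurable_snd).ennreal_toReal.pow_const p)

/-- An index other than `argMax` never exceeds the maximum of the others, so one summand survives.
At a tie this summand is `0`, in agreement with a ratio equal to `1`; here the values must be
neither `0` nor `∞`. -/
theorem one_sub_pow_ratio_eq_sum_gap {s : Finset ℕ} (hs : s.Nonempty) {y : ℕ → ℝ≥0∞}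
    (h0 : ∀ j ∈ s, y j ≠ 0) (ht : ∀ j ∈ s, y j ≠ ⊤) (p : ℕ) :
    1 - (secondMax s y / firstMax s y).toReal ^ p =
      ∑ i ∈ s, gap p ((s.erase i).sup y) (y i) := by
  have hm := argMax_mem hs y
  rw [Finset.sum_eq_single_of_mem _ hm fun i hi hne =>
    gap_of_le ((le_argMax hi).trans (le_sup_erase hi hne))]
  rw [firstMax_eq hs]
  change 1 - (secondMax s y / y (argMax s y)).toReal ^ p = gap p (secondMax s y) (y (argMax s y))
  unfold gap
  split_ifs with h
  · rfl
  · have : secondMax s y = y (argMax s y) :=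
      le_antisymm ((secondMax_le_firstMax s y).trans_eq (firstMax_eq hs y)) (not_lt.1 h)
    rw [this, ENNReal.div_self (h0 _ hm) (ht _ hm)]
    simp

/-- There is at most one strict winner and, by the next lemma, at least one weak winner. As the law
of the norms may have atoms, these two inequalities replace the statement that the winning
probabilities add up to `1`. -/
theorem sum_indicator_sup_erase_lt_le_one (s : Finset ℕ) (y : ℕ → ℝ≥0∞) :
    ∑ i ∈ s, (if (s.erase i).sup y < y i then (1 : ℝ) else 0) ≤ 1 := by
  rcases s.eq_empty_or_nonempty with rfl | hs
  · simp
  rw [Finset.sum_eq_single_of_mem _ (argMax_mem hs y) fun i hi hne =>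
    if_neg ((le_argMax hi).trans (le_sup_erase hi hne)).not_gt]
  split_ifs <;> simp

theorem one_le_sum_indicator_sup_erase_le {s : Finset ℕ} (hs : s.Nonempty) (y : ℕ → ℝ≥0∞) :
    1 ≤ ∑ i ∈ s, (if (s.erase i).sup y ≤ y i then (1 : ℝ) else 0) := by
  refine le_trans ?_ (Finset.single_le_sum (f := fun i =>
    (if (s.erase i).sup y ≤ y i then (1 : ℝ) else 0)) (fun i _ => ?_) (argMax_mem hs y))
  · rw [if_pos]
    exact (secondMax_le_firstMax s y).trans_eq (firstMax_eq hs y)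
  · split_ifs <;> simp

theorem lt_gap_iff {p : ℕ} (hp : p ≠ 0) {y t : ℝ} (hy : 0 < y) (ht : 0 < t) (ht1 : t < 1)
    (b : ℝ≥0∞) :
    t < gap p (ENNReal.ofReal y) b ↔ ENNReal.ofReal (y * (1 - t) ^ (-(p : ℝ)⁻¹)) < b := by
  have h1t : 0 < 1 - t := by linarith
  have hpR : (0 : ℝ) < p := by positivity
  have hge : 1 ≤ (1 - t) ^ (-(p : ℝ)⁻¹) :=
    Real.one_le_rpow_of_pos_of_le_one_of_nonpos h1t (by linarith) (by simp)
  have hyle : y ≤ y * (1 - t) ^ (-(p : ℝ)⁻¹) := le_mul_of_one_le_right hy.le hge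
  rcases eq_or_ne b ⊤ with rfl | hb
  · simp [gap, hp, ht1]
  obtain ⟨x, hx0, rfl⟩ : ∃ x : ℝ, 0 ≤ x ∧ b = ENNReal.ofReal x :=
    ⟨b.toReal, ENNReal.toReal_nonneg, (ENNReal.ofReal_toReal hb).symm⟩
  rw [ENNReal.ofReal_lt_ofReal_iff_of_nonneg (by positivity)]
  unfold gap
  simp only [ENNReal.ofReal_lt_ofReal_iff_of_nonneg hy.le]
  split_ifs with h
  · have hx : 0 < x := hy.trans h
    rw [← ENNReal.ofReal_div_of_pos hx, ENNReal.toReal_ofReal (by positivity), lt_sub_comm,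
      Real.rpow_neg h1t.le, ← div_eq_mul_inv, div_lt_iff₀ (by positivity), mul_comm x,
      ← div_lt_iff₀ hx]
    rw [← Real.rpow_natCast, ← Real.rpow_lt_rpow_iff (z := (p : ℝ)⁻¹) (by positivity) h1t.le
      (by positivity), ← Real.rpow_mul (by positivity), mul_inv_cancel₀ hpR.ne', Real.rpow_one]
  · exact ⟨fun h' => absurd ht h'.not_gt, fun h' => absurd (hyle.trans_lt h') h⟩

/-! ### Mean gap above a given level -/

section Tail

variable {ν : Measure ℝ≥0∞} [IsProbabilityMeasure ν] {α β C D x₀ : ℝ}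

theorem integral_one_sub_rpow {q : ℝ} (hq : 0 ≤ q) :
    ∫ t in (0 : ℝ)..1, (1 - t) ^ q = 1 / (q + 1) := by
  rw [intervalIntegral.integral_comp_sub_left (fun t => t ^ q) 1]
  rw [integral_rpow (Or.inl (by linarith))]
  simp [Real.zero_rpow (by linarith : q + 1 ≠ 0)]

/-- By the layer-cake formula the mean is the integral over `t` in `(0, 1)` of the tail at `y (1 -
t) ^ (-1/p)`. These thresholds are at least `y`, so the tail error there is at most `D y ^ (-β)`;
the main term integrates `(1 - t) ^ (α/p)`. -/
theorem abs_integral_gap_sub_le {p : ℕ} (hp : p ≠ 0) (hα : 0 < α) (hβ : 0 < β) (hx₀ : 0 < x₀)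
    (hD : 0 ≤ D)
    (htail : ∀ x, x₀ ≤ x → |ν.real (Set.Ioi (ENNReal.ofReal x)) - C * x ^ (-α)| ≤ D * x ^ (-β))
    {y : ℝ} (hy : x₀ ≤ y) :
    |∫ b, gap p (ENNReal.ofReal y) b ∂ν - p / (α + p) * (C * y ^ (-α))| ≤ D * y ^ (-β) := by
  have hy0 : 0 < y := hx₀.trans_le hy
  have hpR : (0 : ℝ) < p := by positivity
  have hmeas : Measurable (gap p (ENNReal.ofReal y)) := (measurable_gap p).comp measurable_prodMk_left
  have hint : Integrable (gap p (ENNReal.ofReal y)) ν :=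
    .of_bound hmeas.aestronglyMeasurable 1 (ae_of_all _ fun b => by
      rw [Real.norm_eq_abs, abs_of_nonneg (gap_mem_Icc _ _ _).1]; exact (gap_mem_Icc _ _ _).2)
  set F : ℝ → ℝ := fun t => ν.real {b | t < gap p (ENNReal.ofReal y) b} with hF
  have hlayer : ∫ b, gap p (ENNReal.ofReal y) b ∂ν = ∫ t in (0 : ℝ)..1, F t := by
    rw [hint.integral_eq_integral_meas_lt (ae_of_all _ fun b => (gap_mem_Icc _ _ _).1),
      intervalIntegral.integral_of_le zero_le_one]
    refine setIntegral_eq_of_subset_of_forall_sdiff_eq_zero (measurableSet_Ioi (a := (0 : ℝ)))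
      (fun _ (h : _ ∈ Set.Ioc (0 : ℝ) 1) => h.1) fun t ht => ?_
    have ht1 : 1 < t := by
      by_contra! h
      exact ht.2 ⟨ht.1, h⟩
    have : {b | t < gap p (ENNReal.ofReal y) b} = ∅ := by
      ext b
      simpa using ((gap_mem_Icc p (ENNReal.ofReal y) b).2.trans ht1.le)
    simp [this]
  have hFi : IntervalIntegrable F volume 0 1 := by
    have hanti : Antitone F := fun s t hst =>
      measureReal_mono (fun b (hb : t < _) => hst.trans_lt hb) (measure_ne_top _ _)
    exact hanti.intervalIntegrable
  have hq : 0 ≤ α / p := by positivity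
  have hGi : IntervalIntegrable (fun t : ℝ => C * y ^ (-α) * (1 - t) ^ (α / p)) volume 0 1 := by
    apply Continuous.intervalIntegrable
    exact continuous_const.mul ((continuous_const.sub continuous_id).rpow_const
      fun _ => Or.inr hq)
  have hG : p / (α + p) * (C * y ^ (-α)) =
      ∫ t in (0 : ℝ)..1, C * y ^ (-α) * (1 - t) ^ (α / p) := by
    rw [intervalIntegral.integral_const_mul, integral_one_sub_rpow hq]
    field_simp
  rw [hlayer, hG, ← intervalIntegral.integral_sub hFi hGi, ← Real.norm_eq_abs]
  refine (intervalIntegral.norm_integral_le_of_norm_le_const_ae (C := D * y ^ (-β)) ?_).trans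
    (by simp)
  -- At `t = 1` the threshold degenerates; this endpoint is a null set.
  have hae : ∀ᵐ t : ℝ, t ≠ 1 := by simp [ae_iff]
  filter_upwards [hae] with t ht1 ht
  rw [Set.uIoc_of_le zero_le_one] at ht
  have htlt : t < 1 := lt_of_le_of_ne ht.2 ht1
  have h1t : 0 < 1 - t := by linarith
  have hge : 1 ≤ (1 - t) ^ (-(p : ℝ)⁻¹) :=
    Real.one_le_rpow_of_pos_of_le_one_of_nonpos h1t (by linarith [ht.1]) (by simp)
  have hyle : y ≤ y * (1 - t) ^ (-(p : ℝ)⁻¹) := le_mul_of_one_le_right hy0.le hge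
  have hset : {b | t < gap p (ENNReal.ofReal y) b} =
      Set.Ioi (ENNReal.ofReal (y * (1 - t) ^ (-(p : ℝ)⁻¹))) := by
    ext b
    exact lt_gap_iff hp hy0 ht.1 htlt b
  have h := htail _ (hy.trans hyle)
  simp only [hF, hset, Real.norm_eq_abs]
  have e : C * y ^ (-α) * (1 - t) ^ (α / p) = C * (y * (1 - t) ^ (-(p : ℝ)⁻¹)) ^ (-α) := by
    rw [Real.mul_rpow hy0.le (by positivity), ← Real.rpow_mul h1t.le, mul_assoc]
    congr 3
    ring
  rw [e]
  refine h.trans (mul_le_mul_of_nonneg_left ?_ hD)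
  exact Real.rpow_le_rpow_of_nonpos hy0 hyle (by linarith)

/-- The hypothesis concerns open rays; a possible atom at `y` is included by letting `x` increase to
`y`. -/
theorem measureReal_Ici_le (hx₀ : 0 < x₀)
    (htail : ∀ x, x₀ ≤ x → |ν.real (Set.Ioi (ENNReal.ofReal x)) - C * x ^ (-α)| ≤ D * x ^ (-β))
    {y : ℝ} (hy : x₀ < y) :
    ν.real (Set.Ici (ENNReal.ofReal y)) ≤ C * y ^ (-α) + D * y ^ (-β) := by
  have hy0 : 0 < y := hx₀.trans hy
  have hlim : Tendsto (fun x : ℝ => C * x ^ (-α) + D * x ^ (-β)) (𝓝[<] y)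
      (𝓝 (C * y ^ (-α) + D * y ^ (-β))) := by
    refine Tendsto.mono_left ?_ nhdsWithin_le_nhds
    exact ((Real.continuousAt_rpow_const y _ (Or.inl hy0.ne')).tendsto.const_mul C).add
      ((Real.continuousAt_rpow_const y _ (Or.inl hy0.ne')).tendsto.const_mul D)
  refine ge_of_tendsto hlim ?_
  filter_upwards [Ioo_mem_nhdsLT hy] with x hx
  have h := (abs_le.1 (htail x hx.1.le)).2
  have h2 : ν.real (Set.Ici (ENNReal.ofReal y)) ≤ ν.real (Set.Ioi (ENNReal.ofReal x)) :=
    measureReal_mono (fun b (hb : _ ≤ b) =>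
      lt_of_lt_of_le ((ENNReal.ofReal_lt_ofReal_iff hy0).2 hx.2) hb) (measure_ne_top _ _)
  linarith

/-- The error term for the conditional mean of `gap`. -/
noncomputable def tailError (D β x₀ : ℝ) (a : ℝ≥0∞) : ℝ :=
  if a ≤ ENNReal.ofReal x₀ then 1 else 2 * D * a.toReal ^ (-β)

theorem measurable_tailError (D β x₀ : ℝ) : Measurable (tailError D β x₀) :=
  Measurable.ite measurableSet_Iic measurable_const
    ((ENNReal.measurable_toReal.pow_const _).const_mul _)

/-- Up to `x₀` the bound is trivial, all quantities being in `[0, 1]`. Beyond it, one `D y ^ (-β)`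
comes from the mean gap and another from replacing `C y ^ (-α)` by the tail. Open rays in the upper
bound and closed rays in the lower one match the strict and weak winners. -/
theorem integral_gap_bounds {p : ℕ} (hp : p ≠ 0) (hα : 0 < α) (hβ : 0 < β) (hx₀ : 0 < x₀)
    (hD : 0 ≤ D) (hν : ν {⊤} = 0)
    (htail : ∀ x, x₀ ≤ x → |ν.real (Set.Ioi (ENNReal.ofReal x)) - C * x ^ (-α)| ≤ D * x ^ (-β))
    (a : ℝ≥0∞) :
    ∫ b, gap p a b ∂ν ≤ p / (α + p) * ν.real (Set.Ioi a) + tailError D β x₀ a ∧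
    p / (α + p) * ν.real (Set.Ici a) ≤ ∫ b, gap p a b ∂ν + tailError D β x₀ a := by
  have hpR : (0 : ℝ) < p := by positivity
  have hq0 : 0 ≤ p / (α + p) := by positivity
  have hq1 : p / (α + p) ≤ 1 := (div_le_one (by positivity)).2 (by linarith)
  have hmeas : Measurable (gap p a) := (measurable_gap p).comp measurable_prodMk_left
  have hint : Integrable (gap p a) ν :=
    .of_bound hmeas.aestronglyMeasurable 1 (ae_of_all _ fun b => by
      rw [Real.norm_eq_abs, abs_of_nonneg (gap_mem_Icc _ _ _).1]; exact (gap_mem_Icc _ _ _).2)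
  have hg0 : 0 ≤ ∫ b, gap p a b ∂ν := integral_nonneg fun b => (gap_mem_Icc p a b).1
  have hg1 : ∫ b, gap p a b ∂ν ≤ 1 :=
    (integral_mono hint (integrable_const 1) fun b => (gap_mem_Icc p a b).2).trans (by simp)
  have hI0 : 0 ≤ ν.real (Set.Ioi a) := measureReal_nonneg
  have hI1 : ν.real (Set.Ici a) ≤ 1 := measureReal_le_one
  by_cases ha : a ≤ ENNReal.ofReal x₀
  · rw [tailError, if_pos ha]
    constructor <;> nlinarith
  rw [tailError, if_neg ha]
  -- At `a = ⊤` the error term is `0 ^ (-β) = 0`, so the second inequality needs `ν {⊤} = 0`.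
  rcases eq_or_ne a ⊤ with rfl | hat
  · have h1 : ∀ b, gap p ⊤ b = 0 := fun b => gap_of_le le_top
    have h2 : ν.real (Set.Ici (⊤ : ℝ≥0∞)) = 0 := by
      rw [Set.Ici_top, measureReal_def, hν]; rfl
    have h2' : ν.real (Set.Ioi (⊤ : ℝ≥0∞)) = 0 := by simp
    have h3 : (0 : ℝ) ^ (-β) = 0 := Real.zero_rpow (by linarith)
    rw [h2, h2']
    simp [h1, h3]
  obtain ⟨y, hy0, rfl⟩ : ∃ y : ℝ, 0 ≤ y ∧ a = ENNReal.ofReal y :=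
    ⟨a.toReal, ENNReal.toReal_nonneg, (ENNReal.ofReal_toReal hat).symm⟩
  have hy : x₀ < y := by
    by_contra! h
    exact ha (ENNReal.ofReal_le_ofReal h)
  rw [ENNReal.toReal_ofReal hy0]
  have h1 := abs_le.1 (abs_integral_gap_sub_le hp hα hβ hx₀ hD htail hy.le)
  have h2 := abs_le.1 (htail y hy.le)
  have h3 := measureReal_Ici_le hx₀ htail hy
  have hE : 0 ≤ D * y ^ (-β) := by positivity
  have h4 : p / (α + p) * (D * y ^ (-β)) ≤ D * y ^ (-β) := mul_le_of_le_one_left hE hq1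
  have h5 := mul_le_mul_of_nonneg_left h3 hq0
  have h6 : p / (α + p) * (C * y ^ (-α)) ≤
      p / (α + p) * (ν.real (Set.Ioi (ENNReal.ofReal y)) + D * y ^ (-β)) :=
    mul_le_mul_of_nonneg_left (by linarith [h2.1]) hq0
  constructor <;> linarith [h1.1, h1.2]

end Tail

/-! ### Measurability and independence of blocks -/

theorem measurable_sup_of_mem {Ω : Type*} [MeasurableSpace Ω] {s : Finset ℕ} {X : ℕ → Ω → ℝ≥0∞}
    (hX : ∀ j ∈ s, Measurable (X j)) : Measurable fun ω => s.sup fun j => X j ω := by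
  simp only [Finset.sup_eq_iSup]
  exact Measurable.biSup _ s.countable_toSet hX

theorem measurable_iSup_comap {ι Ω E : Type*} [MeasurableSpace E] {X : ι → Ω → E} {s : Set ι} {i : ι} (hi : i ∈ s) :
    Measurable[⨆ j ∈ s, MeasurableSpace.comap (X j) inferInstance] (X i) :=
  measurable_iff_comap_le.2 (le_iSup₂_of_le i hi le_rfl)

section Independence

variable {Ω E : Type*} [MeasurableSpace Ω] {μ : Measure Ω} [MeasurableSpace E]

/-- Random variables that depend on disjoint blocks of an independent family are independent. -/
theorem iIndepFun_of_pairwise_disjoint [IsProbabilityMeasure μ] {ι κ F : Type*} [MeasurableSpace F]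
    {X : ι → Ω → E} (hX : ∀ i, Measurable (X i)) (hind : iIndepFun X μ) {G : κ → Set ι}
    (hG : Pairwise fun a b => Disjoint (G a) (G b)) {f : κ → Ω → F}
    (hf : ∀ a, Measurable[⨆ i ∈ G a, MeasurableSpace.comap (X i) inferInstance] (f a)) :
    iIndepFun f μ := by
  classical
  rw [iIndepFun_iff_measure_inter_preimage_eq_mul]
  intro S sets hsets
  induction S using Finset.induction_on with
  | empty => simp
  | insert a S ha ih =>
    rw [Finset.prod_insert ha, Finset.set_biInter_insert,
      ← ih fun i hi => hsets i (Finset.mem_insert_of_mem hi)]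
    have hdis : Disjoint (G a) (⋃ b ∈ S, G b) := by
      rw [Set.disjoint_iUnion₂_right]
      intro b hb
      exact hG fun h => ha (h ▸ hb)
    have h := indep_iSup_of_disjoint (fun i => (hX i).comap_le) hind hdis
    refine (Indep_iff _ _ _).1 h _ _ (hf a (hsets a (Finset.mem_insert_self _ _)))
      (Finset.measurableSet_biInter _ fun b hb => ?_)
    have hle : (⨆ i ∈ G b, MeasurableSpace.comap (X i) inferInstance) ≤
        ⨆ i ∈ ⋃ b ∈ S, G b, MeasurableSpace.comap (X i) inferInstance :=
      biSup_mono fun i hi => Set.mem_biUnion hb hi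
    exact hle _ (hf b (hsets b (Finset.mem_insert_of_mem hb)))

theorem indepFun_of_disjoint {ι F F' : Type*} [MeasurableSpace F]
    [MeasurableSpace F'] {X : ι → Ω → E} (hX : ∀ i, Measurable (X i)) (hind : iIndepFun X μ)
    {S T : Set ι} (hST : Disjoint S T) {f : Ω → F} {g : Ω → F'}
    (hf : Measurable[⨆ i ∈ S, MeasurableSpace.comap (X i) inferInstance] f)
    (hg : Measurable[⨆ i ∈ T, MeasurableSpace.comap (X i) inferInstance] g) :
    IndepFun f g μ := by
  have h := indep_iSup_of_disjoint (fun i => (hX i).comap_le) hind hST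
  exact indep_of_indep_of_le_left (indep_of_indep_of_le_right h hg.comap_le) hf.comap_le

/-- Conditioning on `Y`: by independence the joint law is a product, and Fubini's theorem lets the
bound be checked for each fixed value of `Y`. -/
theorem integral_comp_le_of_indepFun [IsProbabilityMeasure μ] {F : Type*} [MeasurableSpace F]
    {Y : Ω → F} {X : Ω → E} (hY : Measurable Y) (hX : Measurable X) (hind : IndepFun Y X μ)
    {H : F × E → ℝ} (hH : Measurable H) {B : ℝ} (hB : ∀ p, |H p| ≤ B) {r : F → ℝ}
    (hr : Integrable (fun ω => r (Y ω)) μ) (hrm : Measurable r)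
    (hle : ∀ a, ∫ b, H (a, b) ∂(μ.map X) ≤ r a) :
    ∫ ω, H (Y ω, X ω) ∂μ ≤ ∫ ω, r (Y ω) ∂μ := by
  have := Measure.isProbabilityMeasure_map (μ := μ) hX.aemeasurable
  have := Measure.isProbabilityMeasure_map (μ := μ) hY.aemeasurable
  have hHi : Integrable H ((μ.map Y).prod (μ.map X)) :=
    .of_bound hH.aestronglyMeasurable B (ae_of_all _ hB)
  rw [← integral_map (φ := fun ω => (Y ω, X ω)) (hY.prodMk hX).aemeasurable
      hH.aestronglyMeasurable,
    (indepFun_iff_map_prod_eq_prod_map_map hY.aemeasurable hX.aemeasurable).1 hind,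
    integral_prod _ hHi, ← integral_map hY.aemeasurable hrm.aestronglyMeasurable]
  exact integral_mono hHi.integral_prod_left
    ((integrable_map_measure hrm.aestronglyMeasurable hY.aemeasurable).2 hr) hle

end Independence

/-! ### Moments of the ratio of the two largest values -/

section Maxima

variable {Ω : Type*} [MeasurableSpace Ω] {μ : Measure Ω} [IsProbabilityMeasure μ]
  {α β C D c x₀ : ℝ}

theorem measureReal_sup_le_le_exp {X : ℕ → Ω → ℝ≥0∞} (hX : ∀ j, Measurable (X j))
    (hind : iIndepFun X μ) {ν : Measure ℝ≥0∞} (hlaw : ∀ j, μ.map (X j) = ν) (s : Finset ℕ)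
    (a : ℝ≥0∞) :
    μ.real {ω | s.sup (fun j => X j ω) ≤ a} ≤ Real.exp (-(s.card * ν.real (Set.Ioi a))) := by
  have hνp : IsProbabilityMeasure ν := hlaw 0 ▸ Measure.isProbabilityMeasure_map (hX 0).aemeasurable
  have e : {ω | s.sup (fun j => X j ω) ≤ a} = ⋂ j ∈ s, X j ⁻¹' Set.Iic a := by
    ext ω; simp
  have h1 : ∀ j, μ (X j ⁻¹' Set.Iic a) = ν (Set.Iic a) := fun j => by
    rw [← hlaw j, Measure.map_apply (hX j) measurableSet_Iic]
  have h2 : ν.real (Set.Iic a) = 1 - ν.real (Set.Ioi a) := by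
    rw [← Set.compl_Ioi, probReal_compl_eq_one_sub measurableSet_Ioi]
  rw [e, measureReal_def, hind.measure_inter_preimage_eq_mul s fun _ _ => measurableSet_Iic]
  simp only [h1, Finset.prod_const, ENNReal.toReal_pow]
  rw [← measureReal_def, h2, ← mul_neg, Real.exp_nat_mul]
  refine pow_le_pow_left₀ (sub_nonneg.2 measureReal_le_one) ?_ _
  exact Real.one_sub_le_exp_neg _

theorem abs_tailError_le (hβ : 0 < β) (hx₀ : 0 < x₀) (hD : 0 ≤ D) (a : ℝ≥0∞) :
    |tailError D β x₀ a| ≤ 1 + 2 * D * x₀ ^ (-β) := by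
  have h0 : 0 ≤ 2 * D * x₀ ^ (-β) := by positivity
  unfold tailError
  split_ifs with h
  · rw [abs_one]; linarith
  · have : a.toReal ^ (-β) ≤ x₀ ^ (-β) := by
      rcases eq_or_ne a ⊤ with rfl | ha
      · rw [ENNReal.toReal_top, Real.zero_rpow (by linarith)]; positivity
      · refine Real.rpow_le_rpow_of_nonpos hx₀ ?_ (by linarith)
        rw [← ENNReal.ofReal_le_iff_le_toReal ha]
        exact (not_le.1 h).le
    rw [abs_of_nonneg (by positivity)]
    have := mul_le_mul_of_nonneg_left this (by positivity : 0 ≤ 2 * D)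
    linarith

theorem integrable_tailError (hβ : 0 < β) (hx₀ : 0 < x₀) (hD : 0 ≤ D) {Y : Ω → ℝ≥0∞}
    (hY : Measurable Y) : Integrable (fun ω => tailError D β x₀ (Y ω)) μ :=
  .of_bound ((measurable_tailError D β x₀).comp hY).aestronglyMeasurable _
    (ae_of_all _ fun _ => abs_tailError_le hβ hx₀ hD _)

/-- Beyond `x₀`, the event `Y ^ (-β) > t` forces `Y ≤ t ^ (-1/β)`, of probability at most `exp(-b t
^ (α/β))`. Integration over `t` produces the Gamma function and the decisive factor `b ^ (-β/α)`. -/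
theorem integral_tailError_le (hα : 0 < α) (hβ : 0 < β) (hx₀ : 0 < x₀) (hD : 0 ≤ D) {b : ℝ}
    (hb : 0 < b) {Y : Ω → ℝ≥0∞} (hY : Measurable Y)
    (hYle : ∀ x, x₀ ≤ x → μ.real {ω | Y ω ≤ ENNReal.ofReal x} ≤ Real.exp (-(b * x ^ (-α)))) :
    ∫ ω, tailError D β x₀ (Y ω) ∂μ ≤
      Real.exp (-(b * x₀ ^ (-α))) + 2 * D * (b ^ (-(β / α)) * Real.Gamma (β / α + 1)) := by
  set A : Set Ω := {ω | Y ω ≤ ENNReal.ofReal x₀}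
  have hA : MeasurableSet A := measurableSet_le hY measurable_const
  set F : Ω → ℝ := Aᶜ.indicator fun ω => (Y ω).toReal ^ (-β)
  have hFm : Measurable F := (hY.ennreal_toReal.pow_const _).indicator hA.compl
  have hF0 : ∀ ω, 0 ≤ F ω := fun ω => Set.indicator_nonneg (fun _ _ => by positivity) ω
  have hFb : ∀ ω, F ω ≤ 1 + 2 * 1 * x₀ ^ (-β) := fun ω => by
    have h0 : 0 ≤ x₀ ^ (-β) := by positivity
    by_cases h : ω ∈ A
    · simp only [F, Set.indicator_of_notMem (Set.notMem_compl_iff.2 h)]; linarith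
    · have := (abs_le.1 (abs_tailError_le hβ hx₀ zero_le_one (Y ω))).2
      rw [tailError, if_neg (show ¬ Y ω ≤ ENNReal.ofReal x₀ from h)] at this
      simp only [F, Set.indicator_of_mem (Set.mem_compl h)]
      have h2 : 0 ≤ (Y ω).toReal ^ (-β) := by positivity
      linarith
  have hFi : Integrable F μ := .of_bound hFm.aestronglyMeasurable _ (ae_of_all _ fun ω => by
    rw [Real.norm_eq_abs, abs_of_nonneg (hF0 ω)]; exact hFb ω)
  have e : (fun ω => tailError D β x₀ (Y ω)) = fun ω => A.indicator (fun _ => (1 : ℝ)) ω + 2 * D * F ω := by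
    ext ω
    by_cases h : ω ∈ A
    · have h' : Y ω ≤ ENNReal.ofReal x₀ := h
      simp [tailError, F, h, h']
    · have h' : ¬ Y ω ≤ ENNReal.ofReal x₀ := h
      simp [tailError, F, h, h']
  rw [e, integral_add ((integrable_const (1 : ℝ)).indicator hA) (hFi.const_mul _),
    integral_const_mul]
  have hAi : ∫ ω, A.indicator (fun _ => (1 : ℝ)) ω ∂μ = μ.real A := integral_indicator_one hA
  rw [hAi]
  refine add_le_add (hYle x₀ le_rfl) (mul_le_mul_of_nonneg_left ?_ (by positivity))
  have hp : 0 < α / β := by positivity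
  have hexp : IntegrableOn (fun t : ℝ => Real.exp (-b * t ^ (α / β))) (Set.Ioi 0) := by
    simpa using integrableOn_rpow_mul_exp_neg_mul_rpow (s := 0) (by norm_num) hp hb
  have hval := integral_exp_neg_mul_rpow hp hb
  rw [show -1 / (α / β) = -(β / α) by field_simp, one_div_div] at hval
  rw [hFi.integral_eq_integral_meas_lt (ae_of_all _ hF0), ← hval]
  refine integral_mono_of_nonneg (ae_of_all _ fun _ => measureReal_nonneg) hexp ?_
  filter_upwards [ae_restrict_mem measurableSet_Ioi] with t ht
  have ht : 0 < t := ht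
  -- The hypothesis on `Y` is available only beyond `x₀`; in the other case `Y > x₀` already gives
  -- `Y ^ (-β) ≤ t`, and the event is empty.
  by_cases hcase : x₀ < t ^ (-β⁻¹)
  · refine (measureReal_mono (fun ω hω => ?_) (measure_ne_top _ _)).trans
      ((hYle _ hcase.le).trans (le_of_eq ?_))
    · have hω : t < F ω := hω
      have hnA : ω ∉ A := fun h => by
        simp only [F, Set.indicator_of_notMem (Set.notMem_compl_iff.2 h)] at hω
        linarith
      simp only [F, Set.indicator_of_mem (Set.mem_compl hnA)] at hω
      have htop : Y ω ≠ ⊤ := fun h => by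
        rw [h, ENNReal.toReal_top, Real.zero_rpow (by linarith)] at hω
        linarith
      have hpos : 0 < (Y ω).toReal := hx₀.trans_le
        ((ENNReal.ofReal_le_iff_le_toReal htop).1 (not_le.1 hnA).le)
      refine ENNReal.le_ofReal_iff_toReal_le htop (by positivity) |>.2 ?_
      have := Real.rpow_le_rpow_of_nonpos ht hω.le (z := -β⁻¹) (by simp [hβ.le])
      rwa [← Real.rpow_mul hpos.le, neg_mul_neg, mul_inv_cancel₀ hβ.ne', Real.rpow_one] at this
    · rw [← Real.rpow_mul ht.le]
      congr 1
      rw [neg_mul]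
      field_simp
  · have : {ω | t < F ω} = ∅ := by
      ext ω
      simp only [Set.mem_ofPred_eq, Set.mem_empty_iff_false, iff_false, not_lt]
      by_cases h : ω ∈ A
      · simp only [F, Set.indicator_of_notMem (Set.notMem_compl_iff.2 h)]; exact ht.le
      simp only [F, Set.indicator_of_mem (Set.mem_compl h)]
      rcases eq_or_ne (Y ω) ⊤ with htop | htop
      · rw [htop, ENNReal.toReal_top, Real.zero_rpow (by linarith)]; exact ht.le
      have hle : x₀ ≤ (Y ω).toReal := (ENNReal.ofReal_le_iff_le_toReal htop).1 (not_le.1 h).le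
      have h1 : t ^ (-β⁻¹) ≤ (Y ω).toReal := (not_lt.1 hcase).trans hle
      have := Real.rpow_le_rpow_of_nonpos (by positivity) h1 (z := -β) (by linarith)
      rwa [← Real.rpow_mul ht.le, neg_mul_neg, inv_mul_cancel₀ hβ.ne', Real.rpow_one] at this
    rw [this]
    simp only [measureReal_empty]
    positivity

/-- The moments of the ratio of the two largest values in a group of an i.i.d. sample, up to the
effect of the second-order tail. -/
theorem abs_integral_ratio_pow_sub_le {X : ℕ → Ω → ℝ≥0∞} (hX : ∀ j, Measurable (X j))
    (hind : iIndepFun X μ) {ν : Measure ℝ≥0∞} (hlaw : ∀ j, μ.map (X j) = ν) (hν0 : ν {0} = 0)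
    (hν : ν {⊤} = 0) (hα : 0 < α) (hβ : 0 < β) (hx₀ : 0 < x₀) (hD : 0 ≤ D) (hc : 0 < c)
    (htail : ∀ x, x₀ ≤ x → |ν.real (Set.Ioi (ENNReal.ofReal x)) - C * x ^ (-α)| ≤ D * x ^ (-β))
    (hlow : ∀ x, x₀ ≤ x → c * x ^ (-α) ≤ ν.real (Set.Ioi (ENNReal.ofReal x)))
    {s : Finset ℕ} (hs : 2 ≤ s.card) {p : ℕ} (hp : p ≠ 0)
    (hκ : Measurable fun ω =>
      (secondMax s (fun j => X j ω) / firstMax s (fun j => X j ω)).toReal) :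
    |∫ ω, (secondMax s (fun j => X j ω) / firstMax s (fun j => X j ω)).toReal ^ p ∂μ -
        α / (α + p)| ≤
      s.card * (Real.exp (-((s.card - 1) * c * x₀ ^ (-α))) +
        2 * D * (((s.card - 1) * c) ^ (-(β / α)) * Real.Gamma (β / α + 1))) := by
  have hνp : IsProbabilityMeasure ν := hlaw 0 ▸ Measure.isProbabilityMeasure_map (hX 0).aemeasurable
  have hne : s.Nonempty := Finset.card_pos.1 (by omega)
  have hpR : (0 : ℝ) < p := by positivity
  set q : ℝ := p / (α + p) with hq
  have hq0 : 0 ≤ q := by positivity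
  have hq1 : q ≤ 1 := (div_le_one (by positivity)).2 (by linarith)
  have hb : 0 < ((s.card : ℝ) - 1) * c := by
    have : (2 : ℝ) ≤ s.card := by exact_mod_cast hs
    have : 0 < (s.card : ℝ) - 1 := by linarith
    positivity
  set R := Real.exp (-((s.card - 1) * c * x₀ ^ (-α))) +
        2 * D * (((s.card - 1) * c) ^ (-(β / α)) * Real.Gamma (β / α + 1))
  set Y : ℕ → Ω → ℝ≥0∞ := fun i ω => (s.erase i).sup fun j => X j ω
  have hYm : ∀ i, Measurable (Y i) := fun i => measurable_sup_of_mem fun j _ => hX j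
  have hYX : ∀ i, IndepFun (Y i) (X i) μ := fun i => by
    refine indepFun_of_disjoint hX hind (S := ↑(s.erase i)) (T := {i}) (by simp) ?_
      (measurable_iSup_comap rfl)
    exact @measurable_sup_of_mem _ (_) _ _ fun j hj => measurable_iSup_comap hj
  have hYr : ∀ i ∈ s, ∫ ω, tailError D β x₀ (Y i ω) ∂μ ≤ R := fun i hi => by
    refine integral_tailError_le hα hβ hx₀ hD hb (hYm i) fun x hx => ?_
    refine (measureReal_sup_le_le_exp hX hind hlaw (s.erase i) _).trans
      (Real.exp_le_exp.2 (neg_le_neg ?_))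
    rw [Finset.card_erase_of_mem hi, Nat.cast_sub (by omega), Nat.cast_one, mul_assoc]
    exact mul_le_mul_of_nonneg_left (hlow x hx) (pos_of_mul_pos_left hb hc.le).le
  set I : ℕ → Ω → ℝ := fun i ω => if Y i ω < X i ω then 1 else 0
  set J : ℕ → Ω → ℝ := fun i ω => if Y i ω ≤ X i ω then 1 else 0
  set g : ℕ → Ω → ℝ := fun i ω => gap p (Y i ω) (X i ω)
  have hIm : Measurable fun x : ℝ≥0∞ × ℝ≥0∞ => if x.1 < x.2 then (1 : ℝ) else 0 :=
    Measurable.ite (measurableSet_lt measurable_fst measurable_snd) measurable_const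
      measurable_const
  have hJm : Measurable fun x : ℝ≥0∞ × ℝ≥0∞ => if x.1 ≤ x.2 then (1 : ℝ) else 0 :=
    Measurable.ite (measurableSet_le measurable_fst measurable_snd) measurable_const
      measurable_const
  have hIi : ∀ i, Integrable (I i) μ := fun i =>
    .of_bound (hIm.comp ((hYm i).prodMk (hX i))).aestronglyMeasurable 1
      (ae_of_all _ fun ω => by simp only [I]; split_ifs <;> simp)
  have hJi : ∀ i, Integrable (J i) μ := fun i =>
    .of_bound (hJm.comp ((hYm i).prodMk (hX i))).aestronglyMeasurable 1
      (ae_of_all _ fun ω => by simp only [J]; split_ifs <;> simp)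
  have hgi : ∀ i, Integrable (g i) μ := fun i =>
    .of_bound ((measurable_gap p).comp ((hYm i).prodMk (hX i))).aestronglyMeasurable 1
      (ae_of_all _ fun ω => by
        rw [Real.norm_eq_abs, abs_of_nonneg (gap_mem_Icc _ _ _).1]; exact (gap_mem_Icc _ _ _).2)
  have hgν : ∀ a, Integrable (gap p a) ν := fun a =>
    .of_bound ((measurable_gap p).comp measurable_prodMk_left).aestronglyMeasurable 1
      (ae_of_all _ fun b => by
        rw [Real.norm_eq_abs, abs_of_nonneg (gap_mem_Icc _ _ _).1]; exact (gap_mem_Icc _ _ _).2)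
  have hIν : ∀ a, ∫ b, (if a < b then (1 : ℝ) else 0) ∂ν = ν.real (Set.Ioi a) := fun a => by
    rw [← integral_indicator_one measurableSet_Ioi]
    exact integral_congr_ae (ae_of_all _ fun b => by simp [Set.indicator])
  have hJν : ∀ a, ∫ b, (if a ≤ b then (1 : ℝ) else 0) ∂ν = ν.real (Set.Ici a) := fun a => by
    rw [← integral_indicator_one measurableSet_Ici]
    exact integral_congr_ae (ae_of_all _ fun b => by simp [Set.indicator])
  have hIνi : ∀ a, Integrable (fun b => if a < b then (1 : ℝ) else 0) ν := fun a =>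
    .of_bound (hIm.comp measurable_prodMk_left).aestronglyMeasurable 1
      (ae_of_all _ fun b => by split_ifs <;> simp)
  have hJνi : ∀ a, Integrable (fun b => if a ≤ b then (1 : ℝ) else 0) ν := fun a =>
    .of_bound (hJm.comp measurable_prodMk_left).aestronglyMeasurable 1
      (ae_of_all _ fun b => by split_ifs <;> simp)
  -- The strict indicator serves for the upper bound, since its sum over `i` is at most `1`; the
  -- weak one serves for the lower bound, since its sum is at least `1`.
  have hup : ∀ i ∈ s, ∫ ω, g i ω ∂μ ≤ q * ∫ ω, I i ω ∂μ + R := fun i hi => by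
    have h := integral_comp_le_of_indepFun (hYm i) (hX i) (hYX i)
      (H := fun x => gap p x.1 x.2 - q * if x.1 < x.2 then 1 else 0)
      ((measurable_gap p).sub (hIm.const_mul q)) (B := 1) (fun x => by
        have := gap_mem_Icc p x.1 x.2
        split_ifs <;> rw [abs_le] <;> constructor <;> linarith [this.1, this.2])
      (integrable_tailError hβ hx₀ hD (hYm i)) (measurable_tailError D β x₀) fun a => by
        simp only [hlaw]
        rw [integral_sub (hgν a) ((hIνi a).const_mul q), integral_const_mul, hIν]
        linarith [(integral_gap_bounds hp hα hβ hx₀ hD hν htail a).1]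
    have e : ∫ ω, (g i ω - q * I i ω) ∂μ = ∫ ω, g i ω ∂μ - q * ∫ ω, I i ω ∂μ := by
      rw [integral_sub (hgi i) ((hIi i).const_mul q), integral_const_mul]
    have h' : ∫ ω, (g i ω - q * I i ω) ∂μ ≤ ∫ ω, tailError D β x₀ (Y i ω) ∂μ := h
    linarith [hYr i hi]
  have hdown : ∀ i ∈ s, q * ∫ ω, J i ω ∂μ ≤ ∫ ω, g i ω ∂μ + R := fun i hi => by
    have h := integral_comp_le_of_indepFun (hYm i) (hX i) (hYX i)
      (H := fun x => (q * if x.1 ≤ x.2 then 1 else 0) - gap p x.1 x.2)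
      ((hJm.const_mul q).sub (measurable_gap p)) (B := 1) (fun x => by
        have := gap_mem_Icc p x.1 x.2
        split_ifs <;> rw [abs_le] <;> constructor <;> linarith [this.1, this.2])
      (integrable_tailError hβ hx₀ hD (hYm i)) (measurable_tailError D β x₀) fun a => by
        simp only [hlaw]
        rw [integral_sub ((hJνi a).const_mul q) (hgν a), integral_const_mul, hJν]
        linarith [(integral_gap_bounds hp hα hβ hx₀ hD hν htail a).2]
    have e : ∫ ω, (q * J i ω - g i ω) ∂μ = q * ∫ ω, J i ω ∂μ - ∫ ω, g i ω ∂μ := by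
      rw [integral_sub ((hJi i).const_mul q) (hgi i), integral_const_mul]
    have h' : ∫ ω, (q * J i ω - g i ω) ∂μ ≤ ∫ ω, tailError D β x₀ (Y i ω) ∂μ := h
    linarith [hYr i hi]
  have hIsum : ∑ i ∈ s, ∫ ω, I i ω ∂μ ≤ 1 := by
    rw [← integral_finsetSum _ fun i _ => hIi i]
    refine (integral_mono (integrable_finsetSum _ fun i _ => hIi i) (integrable_const 1)
      fun ω => sum_indicator_sup_erase_lt_le_one s fun j => X j ω).trans (by simp)
  have hJsum : 1 ≤ ∑ i ∈ s, ∫ ω, J i ω ∂μ := by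
    rw [← integral_finsetSum _ fun i _ => hJi i]
    refine le_trans (by simp) (integral_mono (integrable_const (1 : ℝ))
      (integrable_finsetSum _ fun i _ => hJi i)
      fun ω => one_le_sum_indicator_sup_erase_le hne fun j => X j ω)
  have hae : ∀ᵐ ω ∂μ, ∀ j, X j ω ≠ 0 ∧ X j ω ≠ ⊤ := by
    refine ae_all_iff.2 fun j => ?_
    have h1 : ∀ᵐ x ∂ν, x ≠ 0 ∧ x ≠ ⊤ := by
      filter_upwards [compl_mem_ae_iff.2 hν0, compl_mem_ae_iff.2 hν] with x h1 h2 using ⟨h1, h2⟩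
    rw [← hlaw j] at h1
    exact ae_of_ae_map (hX j).aemeasurable h1
  set κ : Ω → ℝ := fun ω => (secondMax s (fun j => X j ω) / firstMax s (fun j => X j ω)).toReal
  have hκi : Integrable (fun ω => κ ω ^ p) μ :=
    .of_bound (hκ.pow_const p).aestronglyMeasurable 1 (ae_of_all _ fun ω => by
      have := toReal_div_mem_Icc (secondMax_le_firstMax s fun j => X j ω)
      rw [Real.norm_eq_abs, abs_of_nonneg (pow_nonneg this.1 _)]
      exact pow_le_one₀ this.1 this.2)
  have hkey : 1 - ∫ ω, κ ω ^ p ∂μ = ∑ i ∈ s, ∫ ω, g i ω ∂μ := by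
    rw [← integral_finsetSum _ fun i _ => hgi i]
    have : (1 : ℝ) = ∫ _, 1 ∂μ := by simp
    rw [this, ← integral_sub (integrable_const _) hκi]
    refine integral_congr_ae ?_
    filter_upwards [hae] with ω hω
    exact one_sub_pow_ratio_eq_sum_gap hne (fun j _ => (hω j).1) (fun j _ => (hω j).2) p
  have hu := Finset.sum_le_sum hup
  have hd := Finset.sum_le_sum hdown
  rw [Finset.sum_add_distrib, ← Finset.mul_sum, Finset.sum_const, nsmul_eq_mul] at hu hd
  have hu' := mul_le_mul_of_nonneg_left hIsum hq0
  have hd' := mul_le_mul_of_nonneg_left hJsum hq0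
  have hαq : α / (α + p) = 1 - q := by rw [hq]; field_simp; ring
  rw [hαq, abs_le]
  constructor <;> linarith

end Maxima

/-! ### The norm of a cone -/

open NormedCone

section Cone

variable {K : Type*} [EMetricSpace K] [AddCommMonoid K] [DistribMulAction {a : ℝ // 0 < a} K]
  [NormedCone K]

theorem coneNorm_smul (a : {a : ℝ // 0 < a}) (x : K) :
    coneNorm (a • x) = ENNReal.ofReal a * coneNorm x :=
  edist_smul_origin a x

theorem coneNorm_ne_zero {x : K} (hx : x ∈ punctured K) : coneNorm x ≠ 0 := fun h =>
  hx.1 (edist_eq_zero.1 h)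

/-- If `x` had infinite norm, so would every `a • x` by homogeneity, which is incompatible with `a •
x` tending to the origin. -/
theorem coneNorm_ne_top {x : K} (hx : x ∈ punctured K) : coneNorm x ≠ ⊤ := by
  intro h
  have hlim := (tendsto_origin x hx.2).edist (tendsto_const_nhds (x := (origin : K)))
  rw [edist_self] at hlim
  have hc : ∀ a : {a : ℝ // 0 < a}, edist (a • x) (origin : K) = ⊤ := fun a => by
    have := coneNorm_smul a x
    rw [h, ENNReal.mul_top (by simpa using a.2)] at this
    exact this
  simp only [hc] at hlim
  have hne : NeBot (comap (Subtype.val : {a : ℝ // 0 < a} → ℝ) (𝓝 0)) := by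
    rw [comap_neBot_iff]
    intro t ht
    obtain ⟨δ, hδ, hball⟩ := Metric.mem_nhds_iff.1 ht
    refine ⟨⟨δ / 2, half_pos hδ⟩, hball ?_⟩
    rw [Metric.mem_ball, Real.dist_eq, sub_zero, abs_of_pos (half_pos hδ)]
    exact half_lt_self hδ
  exact ENNReal.top_ne_zero (tendsto_nhds_unique tendsto_const_nhds hlim)

theorem direction_mem_unitSphere {x : K} (hx : x ∈ punctured K) : direction x ∈ unitSphere K := by
  have h0 : 0 < (coneNorm x).toReal := ENNReal.toReal_pos (coneNorm_ne_zero hx) (coneNorm_ne_top hx)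
  rw [direction, dif_pos h0, unitSphere, Set.mem_ofPred_eq, coneNorm_smul]
  simp only
  rw [ENNReal.ofReal_inv_of_pos h0, ENNReal.ofReal_toReal (coneNorm_ne_top hx)]
  exact ENNReal.inv_mul_cancel (coneNorm_ne_zero hx) (coneNorm_ne_top hx)

theorem measurable_coneNorm [MeasurableSpace K] [BorelSpace K] :
    Measurable (coneNorm : K → ℝ≥0∞) :=
  (continuous_id.edist continuous_const).measurable

end Cone

/-! ### Slow variation and positivity of the leading constant -/

/-- If `x ^ α F(x)` is slowly varying, then `F` is not `O(x ^ (-β))` for any `β > α`. -/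
theorem not_le_rpow_of_slowlyVarying {F L : ℝ → ℝ} {α β D x₁ : ℝ} (hαβ : α < β)
    (hF : ∀ x, 0 ≤ F x) (hL : SlowlyVarying L)
    (hFL : Tendsto (fun x => x ^ α / L x * F x) atTop (𝓝 1)) :
    ¬ ∀ x, x₁ ≤ x → F x ≤ D * x ^ (-β) := by
  intro hle
  set h : ℝ → ℝ := fun x => x ^ α * F x with hh
  have hFL' : Tendsto (fun x => h x / L x) atTop (𝓝 1) := by
    refine hFL.congr fun x => ?_
    simp only [hh]; ring
  have hpos : ∀ᶠ x in atTop, 0 < h x := by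
    filter_upwards [hFL'.eventually (lt_mem_nhds one_pos), eventually_gt_atTop 0] with x hx hx0
    refine lt_of_le_of_ne (mul_nonneg (by positivity) (hF x)) fun h0 => ?_
    rw [← h0, zero_div] at hx
    exact lt_irrefl _ hx
  have h2 : Tendsto (fun x : ℝ => 2 * x) atTop atTop := tendsto_id.const_mul_atTop two_pos
  have hratio : Tendsto (fun x => h (2 * x) / h x) atTop (𝓝 1) := by
    have hr := ((hFL'.comp h2).mul (hL 2 two_pos)).div hFL' one_ne_zero
    rw [one_mul, div_one] at hr
    refine hr.congr' ?_
    filter_upwards [hFL'.eventually (lt_mem_nhds one_pos),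
      h2.eventually (hFL'.eventually (lt_mem_nhds one_pos)), hpos] with x hx hx2 hp
    -- No sign of `L` is assumed; a zero of `L` would make the quotient `0`, which is excluded near
    -- the limit `1`.
    have l1 : L x ≠ 0 := fun h0 => by rw [h0, div_zero] at hx; exact lt_irrefl _ hx
    have l2 : L (2 * x) ≠ 0 := fun h0 => by rw [h0, div_zero] at hx2; exact lt_irrefl _ hx2
    simp only [Function.comp_apply, Pi.div_apply]
    have := hp.ne'
    field_simp
  set γ := β - α with hγ
  have hγ0 : 0 < γ := sub_pos.2 hαβ
  -- Eventually `h` loses at most the factor `ρ` per doubling of its argument, whereas the bound `D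
  -- x ^ (-γ)` loses `ρ ^ 2`. Along `2 ^ k * X` this forces `h X ≤ 0`.
  set ρ : ℝ := 2 ^ (-(γ / 2)) with hρ
  have hρ1 : ρ < 1 := Real.rpow_lt_one_of_one_lt_of_neg one_lt_two (by linarith)
  have hρ0 : 0 < ρ := by positivity
  obtain ⟨X, hX⟩ := eventually_atTop.1 ((hratio.eventually (lt_mem_nhds hρ1)).and
    (hpos.and (eventually_ge_atTop (max x₁ 1))))
  have hX1 : 1 ≤ X := (le_max_right _ _).trans (hX X le_rfl).2.2
  have hX0 : 0 < X := by linarith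
  have hXk : ∀ k : ℕ, X ≤ 2 ^ k * X := fun k => le_mul_of_one_le_left hX0.le (one_le_pow₀ one_le_two)
  have hgrow : ∀ k : ℕ, ρ ^ k * h X ≤ h (2 ^ k * X) := by
    intro k
    induction k with
    | zero => simp
    | succ k ih =>
      obtain ⟨h1, h3, -⟩ := hX _ (hXk k)
      rw [lt_div_iff₀ h3] at h1
      rw [pow_succ, pow_succ', mul_assoc 2]
      nlinarith
  have hbound : ∀ x, X ≤ x → h x ≤ D * x ^ (-γ) := by
    intro x hx
    have hx0 : 0 < x := hX0.trans_le hx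
    have h1 := hle x ((le_max_left _ _).trans (hX x hx).2.2)
    calc h x ≤ x ^ α * (D * x ^ (-β)) := mul_le_mul_of_nonneg_left h1 (by positivity)
      _ = D * (x ^ α * x ^ (-β)) := by ring
      _ = D * x ^ (-γ) := by rw [← Real.rpow_add hx0]; congr 2; rw [hγ]; ring
  have hlim : Tendsto (fun k : ℕ => D * X ^ (-γ) * ρ ^ k) atTop (𝓝 0) := by
    simpa using (tendsto_pow_atTop_nhds_zero_of_lt_one hρ0.le hρ1).const_mul (D * X ^ (-γ))
  have hle' : ∀ k : ℕ, h X ≤ D * X ^ (-γ) * ρ ^ k := by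
    intro k
    have h1 := (hgrow k).trans (hbound _ (hXk k))
    have e : ((2 : ℝ) ^ k) ^ (-γ) = ρ ^ k * ρ ^ k := by
      rw [← Real.rpow_natCast 2 k, ← Real.rpow_mul zero_le_two, hρ, ← Real.rpow_natCast,
        ← Real.rpow_mul zero_le_two, ← Real.rpow_add two_pos]
      congr 1; ring
    rw [Real.mul_rpow (by positivity) hX0.le, e] at h1
    have hk : 0 < ρ ^ k := by positivity
    have h2 : ρ ^ k * h X ≤ ρ ^ k * (D * X ^ (-γ) * ρ ^ k) := by linarith
    exact le_of_mul_le_mul_left h2 hk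
  exact absurd (ge_of_tendsto' hlim hle') (hX X le_rfl).2.1.not_ge

theorem SecondOrderTail.exists_abs_sub_le {Ω K : Type*} [MeasurableSpace Ω] [EMetricSpace K]
    [AddCommMonoid K] [DistribMulAction {a : ℝ // 0 < a} K] [NormedCone K] {μ : Measure Ω}
    {X : Ω → K} {α : ℝ} {β : EReal} {C₁ C₂ : ℝ} (hαβ : (α : EReal) < β)
    (h : SecondOrderTail μ X α β C₁ C₂) :
    ∃ b D x₁ : ℝ, α < b ∧ 0 ≤ D ∧ (β = ⊤ → D = 0) ∧ (β ≠ ⊤ → b = β.toReal) ∧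
      ∀ x, x₁ ≤ x →
        |μ.real {ω | ENNReal.ofReal x < coneNorm (X ω)} - C₁ * x ^ (-α)| ≤ D * x ^ (-b) := by
  have h1 := h.def one_pos
  by_cases hβ : β = ⊤
  · obtain ⟨x₁, hx₁⟩ := eventually_atTop.1 h1
    -- For `β = ∞` the error vanishes, and any exponent above `α` will do.
    refine ⟨α + 1, 0, x₁, by linarith, le_rfl, fun _ => rfl, fun h => absurd hβ h, fun x hx => ?_⟩
    simpa [negPow, hβ] using hx₁ x hx
  · obtain ⟨x₁, hx₁⟩ := eventually_atTop.1 (h1.and (eventually_ge_atTop 0))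
    have hbot : β ≠ ⊥ := (bot_le.trans_lt hαβ).ne'
    -- The extra `1` absorbs the `o(x ^ (-β))` term.
    refine ⟨β.toReal, |C₂| + 1, x₁, ?_, by positivity, fun h => absurd h hβ, fun _ => rfl,
      fun x hx => ?_⟩
    · rwa [← EReal.coe_toReal hβ hbot, EReal.coe_lt_coe_iff] at hαβ
    · obtain ⟨h2, hx0⟩ := hx₁ x hx
      simp only [negPow, if_neg hβ, one_mul, Real.norm_eq_abs] at h2
      have hp : 0 ≤ x ^ (-β.toReal) := by positivity
      rw [abs_of_nonneg hp] at h2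
      set A := μ.real {ω | ENNReal.ofReal x < coneNorm (X ω)} - C₁ * x ^ (-α)
      have h3 : |C₂ * x ^ (-β.toReal)| = |C₂| * x ^ (-β.toReal) := by rw [abs_mul, abs_of_nonneg hp]
      have h4 := abs_sub_abs_le_abs_sub A (C₂ * x ^ (-β.toReal))
      linarith

/-- Under regular variation and the second-order condition, the leading constant of the tail is
positive, and the tail is `C₁ x ^ (-α)` up to an error of smaller order. -/
theorem exists_tail_bounds {Ω K : Type*} [MeasurableSpace Ω] [EMetricSpace K]
    [AddCommMonoid K] [DistribMulAction {a : ℝ // 0 < a} K] [NormedCone K] [MeasurableSpace K]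
    {μ : Measure Ω} [IsProbabilityMeasure μ] {X : Ω → K}
    (hval : ∀ᵐ ω ∂μ, X ω ∈ punctured K) {α : ℝ} {β : EReal} {C₁ C₂ : ℝ}
    (hαβ : (α : EReal) < β) (σ : Measure (unitSphere K)) [IsProbabilityMeasure σ]
    (hVR : RegularlyVaryingTail μ X α σ) (h : SecondOrderTail μ X α β C₁ C₂) :
    ∃ b D c x₀ : ℝ, α < b ∧ 0 ≤ D ∧ (β = ⊤ → D = 0) ∧ (β ≠ ⊤ → b = β.toReal) ∧ 0 < c ∧ 0 < x₀ ∧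
      (∀ x, x₀ ≤ x →
        |μ.real {ω | ENNReal.ofReal x < coneNorm (X ω)} - C₁ * x ^ (-α)| ≤ D * x ^ (-b)) ∧
      ∀ x, x₀ ≤ x → c * x ^ (-α) ≤ μ.real {ω | ENNReal.ofReal x < coneNorm (X ω)} := by
  obtain ⟨b, D, x₁, hαb, hD, hD0, hb, htail⟩ := h.exists_abs_sub_le hαβ
  set F : ℝ → ℝ := fun x => μ.real {ω | ENNReal.ofReal x < coneNorm (X ω)}
  have hF0 : ∀ x, 0 ≤ F x := fun x => measureReal_nonneg
  obtain ⟨L, hL, hlim⟩ := hVR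
  have hFL : Tendsto (fun x => x ^ α / L x * F x) atTop (𝓝 1) := by
    -- Only the whole sphere, with empty boundary, is tested: the direction lies on it almost
    -- surely, so the norm alone remains.
    have h1 := hlim Set.univ MeasurableSet.univ (by simp)
    rw [probReal_univ] at h1
    refine h1.congr fun x => ?_
    congr 1
    refine measureReal_congr ?_
    filter_upwards [hval] with ω hω
    refine propext ⟨fun h => h.2, fun h => ⟨?_, h⟩⟩
    exact ⟨⟨_, direction_mem_unitSphere hω⟩, trivial, rfl⟩
  have hC : 0 < C₁ := by
    by_contra! hC
    refine not_le_rpow_of_slowlyVarying (x₁ := max x₁ 0) hαb hF0 hL hFL (D := D) fun x hx => ?_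
    have h1 := (abs_le.1 (htail x ((le_max_left _ _).trans hx))).2
    have hx0 : 0 ≤ x := (le_max_right _ _).trans hx
    have h2 : C₁ * x ^ (-α) ≤ 0 := mul_nonpos_of_nonpos_of_nonneg hC (by positivity)
    simp only [F]
    linarith
  have hsmall : Tendsto (fun x : ℝ => D * x ^ (-(b - α))) atTop (𝓝 0) := by
    simpa using (tendsto_rpow_neg_atTop (sub_pos.2 hαb)).const_mul D
  obtain ⟨x₂, hx₂⟩ := eventually_atTop.1 (hsmall.eventually (gt_mem_nhds (half_pos hC)))
  refine ⟨b, D, C₁ / 2, max 1 (max x₁ x₂), hαb, hD, hD0, hb, half_pos hC, by positivity,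
    fun x hx => htail x ((le_max_left _ _).trans ((le_max_right _ _).trans hx)), fun x hx => ?_⟩
  have hx0 : 0 < x := one_pos.trans_le ((le_max_left _ _).trans hx)
  have h1 := (abs_le.1 (htail x ((le_max_left _ _).trans ((le_max_right _ _).trans hx)))).1
  have h2 := hx₂ x ((le_max_right _ _).trans ((le_max_right _ _).trans hx))
  have e : D * x ^ (-b) = D * x ^ (-(b - α)) * x ^ (-α) := by
    rw [mul_assoc, ← Real.rpow_add hx0]; congr 2; ring
  rw [e] at h1
  have h3 := mul_le_mul_of_nonneg_right h2.le (Real.rpow_nonneg hx0.le (-α))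
  linarith

/-! ### Growth rates of the number and the size of the groups -/

section Rates

theorem Asymptotics.IsEquivalent.eventually_bounds {f g : ℕ → ℝ} (h : f ~[atTop] g)
    (hg : ∀ N, 0 ≤ g N) : ∀ᶠ N in atTop, g N / 2 ≤ f N ∧ f N ≤ 2 * g N := by
  filter_upwards [h.isLittleO.def (show (0 : ℝ) < 1 / 2 by norm_num)] with N hN
  rw [Pi.sub_apply, Real.norm_eq_abs, Real.norm_eq_abs, abs_of_nonneg (hg N)] at hN
  have := abs_le.1 hN
  constructor <;> linarith [hg N, this.1, this.2]

theorem zeta_pos {α : ℝ} {β : EReal} (hα : 0 < α) (hαβ : (α : EReal) < β) (hβ : β ≠ ⊤) :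
    0 < zeta α β := by
  have hbot : β ≠ ⊥ := (bot_le.trans_lt hαβ).ne'
  rw [← EReal.coe_toReal hβ hbot, EReal.coe_lt_coe_iff] at hαβ
  exact div_pos (sub_pos.2 hαβ) hα

theorem groupCountExponent_le_one {α : ℝ} {β : EReal} (hα : 0 < α) (hαβ : (α : EReal) < β) :
    groupCountExponent α β ≤ 1 := by
  unfold groupCountExponent
  split_ifs with h
  · exact le_rfl
  · have := zeta_pos hα hαβ h
    rw [div_le_one (by positivity)]
    linarith

variable {α : ℝ} {β : EReal} {ε : ℕ → ℝ} {n m : ℕ → ℕ}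

theorem tendsto_groupCount {ε₀ : ℝ} (hε₀' : ε₀ < groupCountExponent α β)
    (hε : Tendsto ε atTop (𝓝 ε₀))
    (hn : (fun N => (n N : ℝ)) ~[atTop] fun N : ℕ => (N : ℝ) ^ (groupCountExponent α β - ε N)) :
    Tendsto n atTop atTop := by
  rw [← tendsto_natCast_atTop_iff (R := ℝ)]
  refine hn.symm.tendsto_atTop ?_
  have hδ : 0 < (groupCountExponent α β - ε₀) / 2 := half_pos (sub_pos.2 hε₀')
  refine tendsto_atTop_mono' _ ?_ ((tendsto_rpow_atTop hδ).comp tendsto_natCast_atTop_atTop)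
  filter_upwards [hε.eventually (gt_mem_nhds (show ε₀ < ε₀ + (groupCountExponent α β - ε₀) / 2
    by linarith)), eventually_ge_atTop 1] with N h1 h2
  exact Real.rpow_le_rpow_of_exponent_le (by exact_mod_cast h2) (by linarith)

theorem eventually_groupCount_le (hα : 0 < α) (hαβ : (α : EReal) < β)
    (hslow : Tendsto (fun N : ℕ => (N : ℝ) ^ ε N) atTop atTop)
    (hn : (fun N => (n N : ℝ)) ~[atTop] fun N : ℕ => (N : ℝ) ^ (groupCountExponent α β - ε N)) :
    ∀ᶠ N in atTop, (n N : ℝ) ≤ 2 * N := by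
  filter_upwards [hn.eventually_bounds fun N => by positivity, hslow.eventually_ge_atTop 1,
    eventually_ge_atTop 1] with N h1 h2 h3
  have h3 : (1 : ℝ) ≤ N := by exact_mod_cast h3
  have hN : (0 : ℝ) < N := by linarith
  refine h1.2.trans (mul_le_mul_of_nonneg_left ?_ zero_le_two)
  rw [Real.rpow_sub hN]
  refine (div_le_self (by positivity) h2).trans ?_
  simpa using Real.rpow_le_rpow_of_exponent_le h3 (groupCountExponent_le_one hα hαβ)

/-- For finite `β` the fixed positive power of `N` in `m` beats the logarithm; for `β = ∞` that
power is absent and the extra hypothesis on `ε` takes its place. -/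
theorem tendsto_groupSize_div_log (hα : 0 < α) (hαβ : (α : EReal) < β)
    (hslow : Tendsto (fun N : ℕ => (N : ℝ) ^ ε N) atTop atTop)
    (hslow' : β = ⊤ → Tendsto (fun N : ℕ => (N : ℝ) ^ ε N / Real.log N) atTop atTop)
    (hm : (fun N => (m N : ℝ)) ~[atTop] fun N : ℕ => (N : ℝ) ^ (groupSizeExponent α β + ε N)) :
    Tendsto (fun N : ℕ => (m N : ℝ) / Real.log N) atTop atTop := by
  have key : Tendsto (fun N : ℕ => (N : ℝ) ^ (groupSizeExponent α β + ε N) / Real.log N)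
      atTop atTop := by
    by_cases hβ : β = ⊤
    · simpa [groupSizeExponent, hβ] using hslow' hβ
    · have hζ := zeta_pos hα hαβ hβ
      have hs : 0 < groupSizeExponent α β := by
        rw [groupSizeExponent, if_neg hβ]; positivity
      have hlog : Tendsto (fun N : ℕ => (N : ℝ) ^ groupSizeExponent α β / Real.log N)
          atTop atTop := by
        have h1 := ((isLittleO_log_rpow_atTop hs).comp_tendsto
          tendsto_natCast_atTop_atTop).tendsto_div_nhds_zero
        have h2 : Tendsto (fun N : ℕ => Real.log N / (N : ℝ) ^ groupSizeExponent α β) atTop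
            (𝓝[>] 0) := by
          refine tendsto_nhdsWithin_iff.2 ⟨h1, ?_⟩
          filter_upwards [eventually_ge_atTop 2] with N hN
          have hN : (1 : ℝ) < N := by exact_mod_cast hN
          exact div_pos (Real.log_pos hN) (by positivity)
        refine h2.inv_tendsto_nhdsGT_zero.congr fun N => ?_
        simp
      refine tendsto_atTop_mono' _ ?_ hlog
      filter_upwards [hslow.eventually_ge_atTop 1, eventually_ge_atTop 1] with N h1 h2
      have h2 : (1 : ℝ) ≤ N := by exact_mod_cast h2
      rw [Real.rpow_add (by linarith)]
      exact div_le_div_of_nonneg_right (le_mul_of_one_le_right (by positivity) h1)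
        (Real.log_nonneg h2)
  refine tendsto_atTop_mono' _ ?_ (key.const_mul_atTop (show (0 : ℝ) < 1 / 2 by norm_num))
  filter_upwards [hm.eventually_bounds fun N => by positivity, eventually_ge_atTop 1]
    with N h1 h2
  have h2 : (1 : ℝ) ≤ N := by exact_mod_cast h2
  rw [← mul_div_assoc]
  exact div_le_div_of_nonneg_right (by linarith [h1.1]) (Real.log_nonneg h2)

theorem tendsto_groupSize
    (h : Tendsto (fun N : ℕ => (m N : ℝ) / Real.log N) atTop atTop) :
    Tendsto m atTop atTop := by
  rw [← tendsto_natCast_atTop_iff (R := ℝ)]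
  have hlog : Tendsto (fun N : ℕ => Real.log N) atTop atTop :=
    Real.tendsto_log_atTop.comp tendsto_natCast_atTop_atTop
  refine (h.atTop_mul_atTop₀ hlog).congr' ?_
  filter_upwards [hlog.eventually_gt_atTop 0] with N hN
  field_simp

theorem tendsto_sqrt_mul_exp_neg {a : ℝ} (ha : 0 < a)
    (hn : ∀ᶠ N in atTop, (n N : ℝ) ≤ 2 * N)
    (hm : Tendsto (fun N : ℕ => (m N : ℝ) / Real.log N) atTop atTop) :
    Tendsto (fun N : ℕ => √(n N) * (m N * Real.exp (-((m N - 1) * a)))) atTop (𝓝 0) := by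
  have hlim : Tendsto (fun N : ℕ => 4 / a * √2 * (√(N : ℝ))⁻¹) atTop (𝓝 0) := by
    simpa using (Real.tendsto_sqrt_atTop.comp
      tendsto_natCast_atTop_atTop).inv_tendsto_atTop.const_mul (4 / a * √2)
  refine squeeze_zero' (Eventually.of_forall fun N => by positivity) ?_ hlim
  filter_upwards [hn, hm.eventually_ge_atTop (4 / a), (tendsto_groupSize hm).eventually_ge_atTop 2,
    eventually_ge_atTop 2] with N h1 h2 h3 h4
  have h3 : (2 : ℝ) ≤ m N := by exact_mod_cast h3
  have h4 : (2 : ℝ) ≤ N := by exact_mod_cast h4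
  have hlog : 0 < Real.log N := Real.log_pos (by linarith)
  rw [le_div_iff₀ hlog, div_mul_eq_mul_div, div_le_iff₀ ha] at h2
  -- Since `m ≥ 2`, `(m - 1) a ≥ m a / 2`. Of the two factors `exp(-m a / 4)`, one absorbs `m` and
  -- the other is at most `1 / N`, because `m ≥ (4 / a) log N`. Together with `√n ≤ √(2 N)` this
  -- leaves a bound of order `1 / √N`.
  have hexp1 : Real.exp (-((m N - 1) * a)) ≤
      Real.exp (-(m N * a / 4)) * Real.exp (-(m N * a / 4)) := by
    rw [← Real.exp_add, Real.exp_le_exp]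
    nlinarith
  have hexp2 : (m N : ℝ) * Real.exp (-(m N * a / 4)) ≤ 4 / a := by
    have h5 := Real.add_one_le_exp (m N * a / 4)
    rw [Real.exp_neg, ← div_eq_mul_inv, div_le_div_iff₀ (Real.exp_pos _) ha]
    linarith
  have hexp3 : Real.exp (-(m N * a / 4)) ≤ (N : ℝ)⁻¹ := by
    rw [← Real.exp_log (show (0 : ℝ) < N by linarith), ← Real.exp_neg, Real.exp_le_exp]
    linarith
  have hsq : √(n N : ℝ) ≤ √2 * √N := by
    rw [← Real.sqrt_mul zero_le_two]
    exact Real.sqrt_le_sqrt h1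
  have hb : (m N : ℝ) * Real.exp (-((m N - 1) * a)) ≤ 4 / a * (N : ℝ)⁻¹ := by
    calc (m N : ℝ) * Real.exp (-((m N - 1) * a))
        ≤ m N * (Real.exp (-(m N * a / 4)) * Real.exp (-(m N * a / 4))) := by gcongr
      _ = (m N * Real.exp (-(m N * a / 4))) * Real.exp (-(m N * a / 4)) := by ring
      _ ≤ 4 / a * (N : ℝ)⁻¹ := by gcongr
  calc √(n N : ℝ) * (m N * Real.exp (-((m N - 1) * a)))
      ≤ (√2 * √N) * (4 / a * (N : ℝ)⁻¹) := by gcongr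
    _ = 4 / a * √2 * (√(N : ℝ))⁻¹ := by
      have hN : 0 < √(N : ℝ) := Real.sqrt_pos.2 (by linarith)
      have hNN : (N : ℝ) = √(N : ℝ) * √(N : ℝ) := (Real.mul_self_sqrt (by linarith)).symm
      generalize √(N : ℝ) = r at hN hNN
      rw [hNN]
      field_simp

/-- The powers `N ^ (ζ / (1 + 2 ζ))` from `√n` and `N ^ (-ζ / (1 + 2 ζ))` from `m ^ (-ζ)` cancel,
and `N ^ (-ε (1/2 + ζ))` is left. -/
theorem tendsto_sqrt_mul_rpow_neg (hα : 0 < α) (hαβ : (α : EReal) < β) (hβ : β ≠ ⊤)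
    (hslow : Tendsto (fun N : ℕ => (N : ℝ) ^ ε N) atTop atTop)
    (hn : (fun N => (n N : ℝ)) ~[atTop] fun N : ℕ => (N : ℝ) ^ (groupCountExponent α β - ε N))
    (hm : (fun N => (m N : ℝ)) ~[atTop] fun N : ℕ => (N : ℝ) ^ (groupSizeExponent α β + ε N)) :
    Tendsto (fun N : ℕ => √(n N) * (m N : ℝ) ^ (-zeta α β)) atTop (𝓝 0) := by
  set ζ := zeta α β
  have hζ : 0 < ζ := zeta_pos hα hαβ hβ
  set A : ℝ := √2 * 2 ^ ζ
  have hlim : Tendsto (fun N : ℕ => A * ((N : ℝ) ^ ε N) ^ (-(1 / 2 + ζ))) atTop (𝓝 0) := by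
    simpa using ((tendsto_rpow_neg_atTop (show 0 < 1 / 2 + ζ by positivity)).comp hslow).const_mul A
  refine squeeze_zero' (Eventually.of_forall fun N => by positivity) ?_ hlim
  filter_upwards [hn.eventually_bounds fun N => by positivity,
    hm.eventually_bounds fun N => by positivity, eventually_ge_atTop 1] with N h1 h2 h3
  have h3 : (1 : ℝ) ≤ N := by exact_mod_cast h3
  have hN : (0 : ℝ) < N := by linarith
  have e1 : √(n N : ℝ) ≤ √2 * (N : ℝ) ^ ((groupCountExponent α β - ε N) / 2) := by
    refine (Real.sqrt_le_sqrt h1.2).trans (le_of_eq ?_)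
    rw [Real.sqrt_mul zero_le_two, Real.sqrt_eq_rpow ((N : ℝ) ^ _), ← Real.rpow_mul hN.le]
    congr 2; ring
  have e2 : (m N : ℝ) ^ (-ζ) ≤ 2 ^ ζ * (N : ℝ) ^ (-ζ * (groupSizeExponent α β + ε N)) := by
    refine (Real.rpow_le_rpow_of_nonpos (by positivity) h2.1 (by linarith)).trans (le_of_eq ?_)
    rw [Real.div_rpow (by positivity) zero_le_two, ← Real.rpow_mul hN.le, Real.rpow_neg zero_le_two,
      div_inv_eq_mul, mul_comm]
    congr 2; ring
  refine (mul_le_mul e1 e2 (by positivity) (by positivity)).trans (le_of_eq ?_)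
  rw [← Real.rpow_mul hN.le, mul_mul_mul_comm, ← Real.rpow_add hN]
  congr 2
  rw [groupCountExponent, groupSizeExponent, if_neg hβ, if_neg hβ]
  change (2 * ζ / (1 + 2 * ζ) - ε N) / 2 + -ζ * (1 / (1 + 2 * ζ) + ε N) = _
  field_simp
  ring

theorem tendsto_sqrt_mul_bias (hα : 0 < α) (hαβ : (α : EReal) < β)
    (hslow : Tendsto (fun N : ℕ => (N : ℝ) ^ ε N) atTop atTop)
    (hslow' : β = ⊤ → Tendsto (fun N : ℕ => (N : ℝ) ^ ε N / Real.log N) atTop atTop)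
    (hn : (fun N => (n N : ℝ)) ~[atTop] fun N : ℕ => (N : ℝ) ^ (groupCountExponent α β - ε N))
    (hm : (fun N => (m N : ℝ)) ~[atTop] fun N : ℕ => (N : ℝ) ^ (groupSizeExponent α β + ε N))
    {b c D x₀ g : ℝ} (hD : β = ⊤ → D = 0) (hb : β ≠ ⊤ → b = β.toReal) (hc : 0 < c)
    (hx₀ : 0 < x₀) :
    Tendsto (fun N : ℕ => √(n N) * (m N * (Real.exp (-((m N - 1) * c * x₀ ^ (-α))) +
      2 * D * (((m N - 1) * c) ^ (-(b / α)) * g)))) atTop (𝓝 0) := by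
  have hml := tendsto_groupSize_div_log hα hαβ hslow hslow' hm
  have h1 := tendsto_sqrt_mul_exp_neg (a := c * x₀ ^ (-α)) (by positivity)
    (eventually_groupCount_le hα hαβ hslow hn) hml
  have h2 : Tendsto (fun N : ℕ => √(n N) * (m N * (2 * D * (((m N - 1) * c) ^ (-(b / α)) * g))))
      atTop (𝓝 0) := by
    by_cases hβ : β = ⊤
    · simp [hD hβ]
    -- Of the exponent `b / α = 1 + ζ`, the `1` cancels the number `m` of summands; the limit `m /
    -- (m - 1) → 1` makes up for the removed element.
    have hζ : b / α = 1 + zeta α β := by rw [hb hβ, zeta]; field_simp; ring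
    have hζ0 := zeta_pos hα hαβ hβ
    have hm1 : Tendsto (fun N : ℕ => (m N : ℝ) / (m N - 1)) atTop (𝓝 1) := by
      have hmR : Tendsto (fun N => (m N : ℝ)) atTop atTop :=
        tendsto_natCast_atTop_atTop.comp (tendsto_groupSize hml)
      have := (tendsto_const_nhds (x := (1 : ℝ))).sub hmR.inv_tendsto_atTop
      have h3 := this.inv₀ (by simp)
      simp only [sub_zero, inv_one] at h3
      refine h3.congr' ?_
      filter_upwards [hmR.eventually_gt_atTop 1] with N hN
      have : (m N : ℝ) - 1 ≠ 0 := by linarith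
      have : (m N : ℝ) ≠ 0 := by linarith
      rw [Pi.inv_apply, ← one_div (m N : ℝ), one_sub_div this, inv_div]
    have h4 := ((tendsto_sqrt_mul_rpow_neg hα hαβ hβ hslow hn hm).mul
      (hm1.rpow_const (p := b / α) (Or.inl one_ne_zero))).const_mul (2 * D * g * c ^ (-(b / α)))
    simp only [zero_mul, mul_zero] at h4
    refine h4.congr' ?_
    filter_upwards [(tendsto_groupSize hml).eventually_ge_atTop 2] with N hN
    have hN : (2 : ℝ) ≤ m N := by exact_mod_cast hN
    have hN1 : 0 < (m N : ℝ) - 1 := by linarith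
    have hN0 : 0 < (m N : ℝ) := by linarith
    have e : (m N : ℝ) ^ (-zeta α β) * (m N : ℝ) ^ (b / α) = m N := by
      rw [← Real.rpow_add hN0, hζ]
      simp
    rw [Real.div_rpow hN0.le hN1.le, Real.mul_rpow hN1.le hc.le, Real.rpow_neg hN1.le]
    calc _ = √(n N) * (((m N : ℝ) ^ (-zeta α β) * (m N : ℝ) ^ (b / α)) *
          (2 * D * (((m N - 1 : ℝ) ^ (b / α))⁻¹ * c ^ (-(b / α)) * g))) := by ring
      _ = _ := by rw [e]
  have h5 := h1.add h2
  rw [add_zero] at h5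
  refine h5.congr fun N => ?_
  rw [mul_assoc ((m N : ℝ) - 1) c]
  ring

end Rates

/-! ### Proof of the main theorem -/

/-- Measurability is required only for indices in `s`, so that the lemma also applies to the
σ-algebra generated by one group; this yields independence of the ratios. -/
theorem measurable_ratio {Ω : Type*} [MeasurableSpace Ω] {s : Finset ℕ} {X : ℕ → Ω → ℝ≥0∞}
    (hX : ∀ j ∈ s, Measurable (X j)) :
    Measurable fun ω => (secondMax s (fun j => X j ω) / firstMax s (fun j => X j ω)).toReal := by
  rcases s.eq_empty_or_nonempty with rfl | hs
  · simp [secondMax, firstMax]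
  have h1 : Measurable fun ω => firstMax s fun j => X j ω := measurable_sup_of_mem hX
  have h2 : Measurable fun ω => secondMax s fun j => X j ω := by
    simp only [secondMax_eq_inf' hs, Finset.inf'_eq_inf, Finset.inf_eq_iInf]
    exact Measurable.biInf _ s.countable_toSet fun i _ =>
      measurable_sup_of_mem fun j hj => hX j (Finset.mem_of_mem_erase hj)
  exact (h2.div h1).ennreal_toReal

theorem mainTheorem4 {K : Type*} [EMetricSpace K] [AddCommMonoid K]
    [DistribMulAction {a : ℝ // 0 < a} K] [NormedCone K] [MeasurableSpace K] [BorelSpace K]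
    {Ω : Type*} [MeasurableSpace Ω] (μ : Measure Ω) [IsProbabilityMeasure μ]
    -- the i.i.d. sample of `K'`-valued random elements
    (ξ : ℕ → Ω → K) (hmeas : ∀ i, Measurable (ξ i))
    (hval : ∀ i, ∀ᵐ ω ∂μ, ξ i ω ∈ NormedCone.punctured K)
    (hindep : iIndepFun ξ μ) (hident : ∀ i, IdentDistrib (ξ i) (ξ 0) μ μ)
    -- regular variation and the second-order condition
    (α : ℝ) (hα : 0 < α) (β : EReal) (hαβ : (α : EReal) < β) (C₁ C₂ : ℝ)
    (σ : Measure (NormedCone.unitSphere K)) [IsProbabilityMeasure σ]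
    (hVR : RegularlyVaryingTail μ (ξ 0) α σ)
    (htail : SecondOrderTail μ (ξ 0) α β C₁ C₂)
    -- `ε` tends to `0` slowly, or to a small positive constant
    (ε : ℕ → ℝ) (ε₀ : ℝ) (hε₀ : 0 ≤ ε₀) (hε₀' : ε₀ < groupCountExponent α β)
    (hε : Tendsto ε atTop (𝓝 ε₀))
    (hslow : Tendsto (fun N : ℕ => (N : ℝ) ^ ε N) atTop atTop)
    (hslow' : β = ⊤ → Tendsto (fun N : ℕ => (N : ℝ) ^ ε N / Real.log N) atTop atTop)
    -- the number of groups, their size, and the groups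
    (n m : ℕ → ℕ)
    (hn : (fun N => (n N : ℝ)) ~[atTop] fun N : ℕ => (N : ℝ) ^ (groupCountExponent α β - ε N))
    (hm : (fun N => (m N : ℝ)) ~[atTop] fun N : ℕ => (N : ℝ) ^ (groupSizeExponent α β + ε N))
    (G : (N : ℕ) → Fin (n N) → Finset ℕ)
    (hGN : ∀ N i, G N i ⊆ Finset.range N) (hGm : ∀ N i, (G N i).card = m N)
    (hGd : ∀ N, Pairwise fun i j => Disjoint (G N i) (G N j)) :
    TendstoInDistribution
      (fun N ω => selfNormalized (fun i => kappa (G N i) (fun j => ξ j ω)) (α / (α + 1)))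
      atTop id (fun _ => μ) (gaussianReal 0 1) := by
  obtain ⟨b, D, c, x₀, hαb, hD, hD0, hb, hc, hx₀, hup, hlow⟩ :=
    exists_tail_bounds (hval 0) hαβ σ hVR htail
  set X : ℕ → Ω → ℝ≥0∞ := fun j ω => coneNorm (ξ j ω)
  have hXm : ∀ j, Measurable (X j) := fun j => measurable_coneNorm.comp (hmeas j)
  have hXind : iIndepFun X μ := hindep.comp (fun _ => coneNorm) fun _ => measurable_coneNorm
  set ν := μ.map (X 0) with hν
  have hlaw : ∀ j, μ.map (X j) = ν := fun j => ((hident j).comp measurable_coneNorm).map_eq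
  have hIoi : ∀ a, ν.real (Set.Ioi a) = μ.real {ω | a < coneNorm (ξ 0 ω)} := fun a => by
    rw [hν, map_measureReal_apply (hXm 0) measurableSet_Ioi]
    rfl
  have hν0 : ν {0} = 0 := by
    rw [hν, Measure.map_apply (hXm 0) (measurableSet_singleton _)]
    refine measure_mono_null ?_ (ae_iff.1 (hval 0))
    exact fun ω hω h => coneNorm_ne_zero h hω
  have hνt : ν {⊤} = 0 := by
    rw [hν, Measure.map_apply (hXm 0) (measurableSet_singleton _)]
    refine measure_mono_null ?_ (ae_iff.1 (hval 0))
    exact fun ω hω h => coneNorm_ne_top h hω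
  set g := Real.Gamma (b / α + 1)
  set δ : ℕ → ℝ := fun N => m N * (Real.exp (-((m N - 1) * c * x₀ ^ (-α))) +
      2 * D * (((m N - 1) * c) ^ (-(b / α)) * g)) with hδdef
  have hδ : Tendsto (fun N => √(n N) * δ N) atTop (𝓝 0) :=
    tendsto_sqrt_mul_bias hα hαβ hslow hslow' hn hm hD0 hb hc hx₀
  have hnt : Tendsto n atTop atTop := tendsto_groupCount hε₀' hε hn
  have hsq : Tendsto (fun N => √(n N : ℝ)) atTop atTop :=
    Real.tendsto_sqrt_atTop.comp (tendsto_natCast_atTop_atTop.comp hnt)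
  have hδ0 : Tendsto δ atTop (𝓝 0) := by
    have h := hδ.mul hsq.inv_tendsto_atTop
    rw [mul_zero] at h
    refine h.congr' ?_
    filter_upwards [hsq.eventually_gt_atTop 0] with N hN
    rw [Pi.inv_apply]
    field_simp
  have hm2 := (tendsto_groupSize (tendsto_groupSize_div_log hα hαβ hslow hslow'
    hm)).eventually_ge_atTop 2
  have hWm : ∀ N i, Measurable fun ω => kappa (G N i) (fun j => ξ j ω) := fun N i =>
    measurable_ratio (X := X) fun j _ => hXm j
  have hbias : ∀ p : ℕ, p ≠ 0 → ∀ᶠ N in atTop, ∀ i,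
      |∫ ω, kappa (G N i) (fun j => ξ j ω) ^ p ∂μ - α / (α + p)| ≤ δ N := by
    intro p hp
    filter_upwards [hm2] with N hN i
    have h := abs_integral_ratio_pow_sub_le hXm hXind hlaw hν0 hνt hα (hα.trans hαb) hx₀ hD hc
      (fun x hx => by rw [hIoi]; exact hup x hx) (fun x hx => by rw [hIoi]; exact hlow x hx)
      (s := G N i) (by rw [hGm]; exact hN) hp (hWm N i)
    rw [hGm] at h
    exact h
  refine tendstoInDistribution_selfNormalized hnt hWm (fun N => ?_) (fun N i ω => ?_)
    (δ := δ) (η := δ) (d := α / (α + 2)) ⟨by positivity, ?_⟩ ?_ ?_ ?_ hδ hδ0 ?_ hδ0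
  · refine iIndepFun_of_pairwise_disjoint hXm hXind (G := fun i => (G N i : Set ℕ))
      (fun i j hij => by exact_mod_cast hGd N hij) fun i => ?_
    exact @measurable_ratio _ (_) _ X fun j hj => measurable_iSup_comap hj
  · exact toReal_div_mem_Icc (secondMax_le_firstMax _ _)
  · exact (div_le_one (by positivity)).2 (by linarith)
  · exact (div_le_one (by positivity)).2 (by linarith)
  -- The limiting variance is positive because `α (α + 2) < (α + 1) ^ 2`.
  · rw [div_pow, div_lt_div_iff₀ (by positivity) (by positivity)]
    nlinarith
  · simpa using hbias 1 one_ne_zero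
  · simpa using hbias 2 two_ne_zero
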